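/- Let $\beta,\gamma,\epsilon$ and $\beta_n,\gamma_n$ ($n\ge 3$) be real constants. For a mass parameter $m>0$ (proportional to Newton's constant $G$) consider on $\{(x^0,\boldsymbol x)\in\mathbb R\times\mathbb R^3\}$ the static, spherically symmetric metric $$ds^2=\mathcal A(r)(dx^0)^2-\mathcal B^{-1}(r)\,\delta_{ij}dx^idx^j,\qquad r=|\boldsymbol x|,$$ $$\mathcal A(r)=1-\frac{2m}{r}+2\beta\frac{m^2}{r^2}-\frac32\beta_3\frac{m^3}{r^3}+\beta_4\frac{m^4}{r^4}+\sum_{n\ge5}\frac{(-1)^n n}{2^{n-2}}\beta_n\frac{m^n}{r^n},$$ $$\mathcal B^{-1}(r)=1+2\gamma\frac{m}{r}+\frac32\epsilon\frac{m^2}{r^2}+\frac12\gamma_3\frac{m^3}{r^3}+\frac1{16}\gamma_4\frac{m^4}{r^4}+\sum_{n\ge5}(\gamma_n-1)\frac{m^n}{r^n}.$$ Suppose that, for some $m_0>0$ and $r_h>0$, with $m=m_0$ both series converge and have positive sums for all $r>r_h$ (then the same holds for $0<m\le m_0$). Put $$\kappa=2(1+\gamma)-\beta+\tfrac34\epsilon,\qquad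 \kappa_3=2\kappa-2\beta(1+\gamma)+\tfrac34\beta_3+\tfrac14\gamma_3 .$$ Let $\boldsymbol N_e$ be a unit vector and $\boldsymbol x_B$ a point with $r_B=|\boldsymbol x_B|>r_h$. Put $\boldsymbol n_B=\boldsymbol x_B/r_B$ and $$r_c=r_B|\boldsymbol N_e\times\boldsymbol n_B| ,$$ and suppose that $\boldsymbol N_e\times\boldsymbol n_B\ne 0$ (the ray is not radial) and that $$|\lambda r_c\boldsymbol N_e+\boldsymbol x_B|>r_h\quad\text{for all }-\infty<\lambda\le 0 .$$ A quasi-Minkowskian light ray emitted at infinity in the direction $\boldsymbol N_e$ and arriving at $\boldsymbol x_B$ is a family, indexed by the small values of $m>0$, of affinely parametrized future-directed null geodesics $x^\alpha(\lambda)$, $-\infty<\lambda\le0$, of the metric with mass parameter $m$, lying in the region $r>r_h$, with $\boldsymbol x(0)=\boldsymbol x_B$ and a fixed arrival time $x^0(0)=ct_B$, such that $|\boldsymbol x(\lambda)|\to\infty$ and the unit tangent $\dot{\boldsymbol x}/|\dot{\boldsymbol x}|\to\boldsymbol N_e$ as $\lambda\to-\infty$, and which is a perturbation in powers of $m$ of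 the half-line $x^0_{(0)}(\lambda)=ct_B+\lambda r_c$, $\boldsymbol x_{(0)}(\lambda)=\lambda r_c\boldsymbol N_e+\boldsymbol x_B$: for each $\lambda\le0$ and all sufficiently small $m>0$, $x^\alpha(\lambda)=x^\alpha_{(0)}(\lambda)+\sum_{n\ge1}m^n\Xi^\alpha_n(\lambda)$, where the functions $\Xi^\alpha_n$ do not depend on $m$ and the series may be differentiated term by term in $\lambda$. Its impact parameter is $b=J/E$, where, with $l_\alpha=g_{\alpha\beta}\dot x^\beta$, $E=l_0$ is the conserved energy and $J=|\boldsymbol x\times(l_1,l_2,l_3)|$ the conserved angular momentum. Then there are numbers $q_n$ ($n\ge1$), independent of $m$ and of the choice of such a ray, such that for every such ray and all sufficiently small $m>0$ its impact parameter is (at each of its points) given by the convergent expansion $$b=r_c\Big[1+\sum_{n=1}^\infty\Big(\frac m{r_c}\Big)^n q_n\Big],$$ and $$q_1=(1+\gamma)\frac{|\boldsymbol N_e\times\boldsymbol n_B|}{1-\boldsymbol N_e\cdot\boldsymbol n_B},$$ $$q_2=\kappa\left[1+(\boldsymbol N_e\cdot\boldsymbol n_B)\frac{\pi-\arccos(\boldsymbol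 N_e\cdot\boldsymbol n_B)}{|\boldsymbol N_e\times\boldsymbol n_B|}\right]-(1+\gamma)^2\frac{1+\boldsymbol N_e\cdot\boldsymbol n_B}{1-\boldsymbol N_e\cdot\boldsymbol n_B},$$ $$q_3=\frac{|\boldsymbol N_e\times\boldsymbol n_B|}{1-\boldsymbol N_e\cdot\boldsymbol n_B}\left\{\kappa_3(1+\boldsymbol N_e\cdot\boldsymbol n_B)+2(1+\gamma)^3\frac{1+\boldsymbol N_e\cdot\boldsymbol n_B}{1-\boldsymbol N_e\cdot\boldsymbol n_B}-(1+\gamma)\kappa\left[1+(1+2\boldsymbol N_e\cdot\boldsymbol n_B)\frac{\pi-\arccos(\boldsymbol N_e\cdot\boldsymbol n_B)}{|\boldsymbol N_e\times\boldsymbol n_B|}\right]\right\}.$$ -/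

import Mathlib

open Filter Topology

namespace LightRay

/-- Triples of spatial coordinates, with the Euclidean norm and scalar product. -/
abbrev E3 : Type := EuclideanSpace ℝ (Fin 3)

/-- Quasi-Cartesian coordinates `(x⁰, x¹, x², x³)`. -/
abbrev Event : Type := Fin 4 → ℝ

/-- The spatial triple of a quadruple. -/
def spatial (X : Event) : E3 := WithLp.toLp 2 (fun i : Fin 3 => X i.succ)

/-- The quadruple with time component `t` and spatial triple `x`. -/
def event (t : ℝ) (x : E3) : Event := Fin.cons (α := fun _ => ℝ) t (fun i : Fin 3 => x i)

/-- The vector product of two triples. -/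
def cross (a b : E3) : E3 := WithLp.toLp 2 (crossProduct a.ofLp b.ofLp)

/-! ### The metric -/

/-- The post-Newtonian parameters. `betaN n` and `gammaN n` are used for `n ≥ 3` only. -/
structure PPN where
  beta : ℝ
  gamma : ℝ
  epsilon : ℝ
  betaN : ℕ → ℝ
  gammaN : ℕ → ℝ

/-- Coefficient of `(m / r) ^ n` in the potential `𝓐`. -/
noncomputable def PPN.aCoeff (P : PPN) : ℕ → ℝ
  | 0 => 1
  | 1 => -2
  | 2 => 2 * P.beta
  | 3 => -(3 / 2) * P.betaN 3
  | 4 => P.betaN 4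
  | n + 5 => (-1) ^ (n + 5) * ((n : ℝ) + 5) / 2 ^ (n + 3) * P.betaN (n + 5)

/-- Coefficient of `(m / r) ^ n` in the potential `𝓑⁻¹`. -/
noncomputable def PPN.bCoeff (P : PPN) : ℕ → ℝ
  | 0 => 1
  | 1 => 2 * P.gamma
  | 2 => 3 / 2 * P.epsilon
  | 3 => 1 / 2 * P.gammaN 3
  | 4 => 1 / 16 * P.gammaN 4
  | n + 5 => P.gammaN (n + 5) - 1

/-- `κ = 2 (1 + γ) - β + 3 ε / 4`. -/
noncomputable def PPN.kappa (P : PPN) : ℝ :=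
  2 * (1 + P.gamma) - P.beta + 3 / 4 * P.epsilon

/-- `κ₃ = 2 κ - 2 β (1 + γ) + 3 β₃ / 4 + γ₃ / 4`. -/
noncomputable def PPN.kappa3 (P : PPN) : ℝ :=
  2 * P.kappa - 2 * P.beta * (1 + P.gamma) + 3 / 4 * P.betaN 3 + 1 / 4 * P.gammaN 3

/-- The potential `𝓐(r)` for the mass parameter `m`. -/
noncomputable def PPN.potA (P : PPN) (m r : ℝ) : ℝ := ∑' n : ℕ, P.aCoeff n * (m / r) ^ n

/-- The potential `𝓑⁻¹(r)` for the mass parameter `m`. -/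
noncomputable def PPN.potBinv (P : PPN) (m r : ℝ) : ℝ := ∑' n : ℕ, P.bCoeff n * (m / r) ^ n

/-- For the mass parameter `m`, the potentials are positive and are represented by
their (convergent) expansions in the whole region `r > rh`. If this holds for `m`, it holds
for every smaller positive mass parameter, with the same `rh`. -/
def PPN.RegularOutside (P : PPN) (m rh : ℝ) : Prop :=
  ∀ r : ℝ, rh < r →
    (Summable fun n : ℕ => P.aCoeff n * (m / r) ^ n) ∧
    (Summable fun n : ℕ => P.bCoeff n * (m / r) ^ n) ∧
    0 < P.potA m r ∧ 0 < P.potBinv m r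

/-- The components `g_{αβ}` of `ds² = 𝓐(r) (dx⁰)² - 𝓑⁻¹(r) δ_{ij} dxⁱ dxʲ`, `r = |x|`. -/
noncomputable def PPN.metric (P : PPN) (m : ℝ) (X : Event) : Matrix (Fin 4) (Fin 4) ℝ :=
  Matrix.diagonal (Fin.cons (α := fun _ => ℝ) (P.potA m ‖spatial X‖)
    (fun _ : Fin 3 => -P.potBinv m ‖spatial X‖))

/-! ### Null geodesics -/

/-- The covariant components `l_α = g_{αβ} V^β` of a vector `V` at the point `X`. -/
noncomputable def covector (g : Event → Matrix (Fin 4) (Fin 4) ℝ) (X V : Event) : Fin 4 → ℝ :=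
  (g X).mulVec V

/-- The partial derivative `∂_α g_{βδ}` at the point `X`. -/
noncomputable def metricDeriv (g : Event → Matrix (Fin 4) (Fin 4) ℝ) (X : Event)
    (α β δ : Fin 4) : ℝ :=
  fderiv ℝ (fun Y : Event => g Y β δ) X (Pi.single α 1)

/-- `X` is, on the parameter interval `S`, an affinely parametrized null geodesic of the metric
`g`, with tangent vector `V`. The geodesic equation is written in covariant form,
`d l_α / ds = (1/2) ∂_α g_{βδ} V^β V^δ`, which is the equation
`g_{αμ} (dV^μ/ds + Γ^μ_{βδ} V^β V^δ) = 0`. -/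
structure IsNullGeodesicOn (g : Event → Matrix (Fin 4) (Fin 4) ℝ) (S : Set ℝ)
    (X V : ℝ → Event) : Prop where
  tangent : ∀ s ∈ S, HasDerivWithinAt X (V s) S s
  geodesic : ∀ s ∈ S, HasDerivWithinAt (fun σ => covector g (X σ) (V σ))
    (fun α => 1 / 2 * ∑ β, ∑ δ, metricDeriv g (X s) α β δ * V s β * V s δ) S s
  null : ∀ s ∈ S, ∑ β, ∑ δ, g (X s) β δ * V s β * V s δ = 0

/-- The impact parameter `b = J / E` at a point `X` of a null geodesic with tangent vector `V`:
`E = l₀`, and `J = |x × l|` is the absolute value of the component `l_φ` of the covariant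
tangent vector with respect to the azimuth in the plane of the motion. -/
noncomputable def impactParameter (g : Event → Matrix (Fin 4) (Fin 4) ℝ) (X V : Event) : ℝ :=
  ‖cross (spatial X) (spatial (covector g X V))‖ / covector g X V 0

/-! ### Rays emitted at infinity -/

/-- `n_B = x_B / r_B`. -/
noncomputable def unitDir (x : E3) : E3 := ‖x‖⁻¹ • x

/-- `r_c = r_B |N_e × n_B|`. -/
noncomputable def rc (Ne xB : E3) : ℝ := ‖xB‖ * ‖cross Ne (unitDir xB)‖

/-- For the mass parameter `m`, the curve `X` with parameter in `(-∞, 0]` is a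
future-directed light ray in the region `r > rh`, emitted at infinity in the direction `Ne` and
arriving at the point `xB` at the time given by `x⁰ = x0B`. -/
structure IsRayFromInfinity (P : PPN) (m rh : ℝ) (Ne xB : E3) (x0B : ℝ)
    (X V : ℝ → Event) : Prop where
  nullGeodesic : IsNullGeodesicOn (P.metric m) (Set.Iic 0) X V
  future : ∀ s ≤ 0, 0 < V s 0
  region : ∀ s ≤ 0, rh < ‖spatial (X s)‖
  arrival : X 0 = event x0B xB
  fromInfinity : Tendsto (fun s => ‖spatial (X s)‖) atBot atTop
  direction : Tendsto (fun s => unitDir (spatial (V s))) atBot (𝓝 Ne)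

/-- The quasi-Minkowskian ray emitted at infinity in the direction `Ne` and arriving at `xB`,
as a function of the mass parameter `m` (which is proportional to `G`): for every small `m > 0`
the curve `X m`, with tangent vector `V m`, is such a light ray, and it is a perturbation in
powers of `m` of the half-line
`x⁰ = x0B + s r_c`, `x = s r_c Ne + xB`, `-∞ < s ≤ 0`: at every `s` one has, for small `m`,
`X m s = (half-line) + ∑_{n ≥ 1} m ^ n Ξ n s`, and this series may be differentiated term by term
with respect to `s`. -/
structure IsQuasiMinkowskianFromInfinity (P : PPN) (rh : ℝ) (Ne xB : E3) (x0B : ℝ)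
    (X V : ℝ → ℝ → Event) : Prop where
  ray : ∀ᶠ m in 𝓝[>] (0 : ℝ), IsRayFromInfinity P m rh Ne xB x0B (X m) (V m)
  perturbation : ∃ Ξ Ξ' : ℕ → ℝ → Event,
    (∀ s ≤ 0, Ξ 0 s = event (x0B + s * rc Ne xB) ((s * rc Ne xB) • Ne + xB)) ∧
    (∀ n, ∀ s ≤ 0, HasDerivWithinAt (Ξ n) (Ξ' n s) (Set.Iic 0) s) ∧
    (∀ s ≤ 0, ∀ᶠ m in 𝓝[>] (0 : ℝ),
      HasSum (fun n : ℕ => m ^ n • Ξ n s) (X m s) ∧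
      HasSum (fun n : ℕ => m ^ n • Ξ' n s) (V m s))

end LightRay

namespace LightRay

/-! ### Power series in one real variable -/

/-! A null geodesic of the static isotropic metric is a ray of geometrical optics in a medium whose
squared refractive index `𝓑⁻¹ / 𝓐` depends on `m / r` only. The conserved energy and angular
momentum turn the ray into an orbit problem: as a function of the swept angle `φ`, `w = m / r`
satisfies `w'' = -w + μ² F(w)`, `w(0) = 0`, `w'(0) = μ`, where `μ = m / b` and `F` is half the
derivative of the squared index, with `F(x) = (1 + γ) + 2 κ x + 3 κ₃ x² + O(x³)`
(`PPN.force_expansion`). The ray starts on the side `-N_e` and ends on the side `n_B`, so the total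
angle is `ψ = π - arccos (N_e · n_B)`, independent of `m`; the arrival condition is `w(ψ) = m / r_B`
(`IsRayFromInfinity.exists_orbit`, which rests on `exists_orbit_of_sweep`).

Solving the orbit equation up to `O(μ⁵)` (`exists_orbit_expansion`) makes the arrival condition an
equation between `h = m / r_c` and `μ = h / Q`, with `Q = b / r_c`. The function `b` is analytic in
`m` at `0`, because the velocity at the arrival point is a power series in `m`
(`IsQuasiMinkowskianFromInfinity.exists_analytic_impact`). Comparing powers of `h` then gives the
first three coefficients (`coeff_of_inverse_expansion`, `coeff_formulas`).

The coefficients do not depend on the ray because the arrival condition has at most one small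
solution `μ` (`exists_orbit_unique`): two rays have the same `b` for all small `m`. -/

theorem summable_of_abs_lt {c : ℕ → ℝ} {x₀ x : ℝ} (h : Summable fun n => c n * x₀ ^ n)
    (hx : |x| < |x₀|) : Summable fun n => c n * x ^ n :=
  summable_powerSeries_of_norm_lt h.hasSum.tendsto_sum_nat.cauchySeq (by simpa using hx)

theorem eventually_abs_lt {δ : ℝ} (hδ : 0 < δ) : ∀ᶠ x : ℝ in 𝓝 0, |x| < δ := by
  filter_upwards [Metric.ball_mem_nhds (0 : ℝ) hδ] with x hx
  simpa using hx

theorem analyticAt_tsum {c : ℕ → ℝ} {x₀ : ℝ} (hx₀ : x₀ ≠ 0)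
    (h : Summable fun n => c n * x₀ ^ n) : AnalyticAt ℝ (fun x => ∑' n, c n * x ^ n) 0 := by
  refine ⟨FormalMultilinearSeries.ofScalars ℝ c, hasFPowerSeriesAt_iff.2 ?_⟩
  filter_upwards [eventually_abs_lt (abs_pos.2 hx₀)] with x hx
  simpa [FormalMultilinearSeries.coeff_ofScalars, mul_comm] using
    (summable_of_abs_lt h hx).hasSum

theorem tsum_eq_sum_add_pow_mul {c : ℕ → ℝ} {x₀ x : ℝ} (h : Summable fun n => c n * x₀ ^ n)
    (hx : |x| < |x₀|) (k : ℕ) :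
    ∑' n, c n * x ^ n = ∑ n ∈ Finset.range k, c n * x ^ n + x ^ k * ∑' n, c (n + k) * x ^ n := by
  rw [← (summable_of_abs_lt h hx).sum_add_tsum_nat_add k, ← tsum_mul_left]
  congr 1
  refine tsum_congr fun n => ?_
  ring

theorem summable_shift {c : ℕ → ℝ} {x₀ : ℝ} (hx₀ : x₀ ≠ 0)
    (h : Summable fun n => c n * x₀ ^ n) (k : ℕ) : Summable fun n => c (n + k) * x₀ ^ n := by
  have := ((summable_nat_add_iff k).2 h).mul_left (x₀ ^ k)⁻¹
  refine this.congr fun n => ?_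
  field_simp
  ring

/-! ### The potentials as functions of `x = m / r` -/

/-- `𝓐` as a function of `m / r`. -/
noncomputable def PPN.seriesA (P : PPN) (x : ℝ) : ℝ := ∑' n : ℕ, P.aCoeff n * x ^ n

/-- `𝓑⁻¹` as a function of `m / r`. -/
noncomputable def PPN.seriesB (P : PPN) (x : ℝ) : ℝ := ∑' n : ℕ, P.bCoeff n * x ^ n

/-- The squared refractive index `𝓑⁻¹ / 𝓐` as a function of `m / r`. -/
noncomputable def PPN.index (P : PPN) (x : ℝ) : ℝ := P.seriesB x / P.seriesA x

/-- Half the derivative of the squared refractive index. -/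
noncomputable def PPN.force (P : PPN) (x : ℝ) : ℝ :=
  (deriv P.seriesB x * P.seriesA x - P.seriesB x * deriv P.seriesA x) / (2 * P.seriesA x ^ 2)

theorem PPN.seriesA_zero (P : PPN) : P.seriesA 0 = 1 := by
  rw [PPN.seriesA, tsum_eq_single 0]
  · simp [PPN.aCoeff]
  · intro n hn; simp [hn]

theorem PPN.seriesB_zero (P : PPN) : P.seriesB 0 = 1 := by
  rw [PPN.seriesB, tsum_eq_single 0]
  · simp [PPN.bCoeff]
  · intro n hn; simp [hn]

theorem deriv_eq_of_cubic_add {f α : ℝ → ℝ} {a b c d x : ℝ}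
    (h : ∀ᶠ y in 𝓝 x, f y = a + b * y + c * y ^ 2 + d * y ^ 3 + y ^ 4 * α y)
    (hα : DifferentiableAt ℝ α x) :
    deriv f x = b + 2 * c * x + 3 * d * x ^ 2 + x ^ 3 * (4 * α x + x * deriv α x) := by
  have hf : f =ᶠ[𝓝 x] fun y => a + b * y + c * y ^ 2 + d * y ^ 3 + y ^ 4 * α y := h
  rw [hf.deriv_eq]
  have h1 := ((((hasDerivAt_id x).const_mul b).const_add a).add
    (((hasDerivAt_id x).pow 2).const_mul c)).add (((hasDerivAt_id x).pow 3).const_mul d)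
  have h2 := h1.add (((hasDerivAt_id x).pow 4).mul hα.hasDerivAt)
  refine HasDerivAt.deriv (HasDerivAt.congr_deriv (f := fun y => a + b * y + c * y ^ 2 + d * y ^ 3 + y ^ 4 * α y) h2 ?_)
  simp
  ring

theorem PPN.analyticAt_force {P : PPN} (hA : AnalyticAt ℝ P.seriesA 0)
    (hB : AnalyticAt ℝ P.seriesB 0) : AnalyticAt ℝ P.force 0 := by
  refine ((hB.deriv.mul hA).sub (hB.mul hA.deriv)).div (analyticAt_const.mul (hA.pow 2)) ?_
  simp [P.seriesA_zero]

/-- The constants `κ` and `κ₃` are exactly what makes the terms of degree less than 3 cancel once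
the denominator of `PPN.force` is cleared. What is left is `x³` times a function continuous at `0`,
hence locally bounded. -/
theorem PPN.force_expansion {P : PPN} {x₀ : ℝ} (hx₀ : x₀ ≠ 0)
    (hA : Summable fun n => P.aCoeff n * x₀ ^ n) (hB : Summable fun n => P.bCoeff n * x₀ ^ n) :
    ∃ C : ℝ, ∀ᶠ x in 𝓝 (0 : ℝ),
      |P.force x - (1 + P.gamma + 2 * P.kappa * x + 3 * P.kappa3 * x ^ 2)| ≤ C * |x| ^ 3 := by
  set α : ℝ → ℝ := fun x => ∑' n, P.aCoeff (n + 4) * x ^ n with hαd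
  set β : ℝ → ℝ := fun x => ∑' n, P.bCoeff (n + 4) * x ^ n with hβd
  have hα : AnalyticAt ℝ α 0 := analyticAt_tsum hx₀ (summable_shift hx₀ hA 4)
  have hβ : AnalyticAt ℝ β 0 := analyticAt_tsum hx₀ (summable_shift hx₀ hB 4)
  have eA : ∀ᶠ x in 𝓝 (0 : ℝ), P.seriesA x
      = 1 + (-2) * x + (2 * P.beta) * x ^ 2 + (-(3 / 2) * P.betaN 3) * x ^ 3 + x ^ 4 * α x := by
    filter_upwards [eventually_abs_lt (abs_pos.2 hx₀)] with x hx
    rw [PPN.seriesA, tsum_eq_sum_add_pow_mul hA hx 4]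
    simp [Finset.sum_range_succ, PPN.aCoeff, hαd]
  have eB : ∀ᶠ x in 𝓝 (0 : ℝ), P.seriesB x
      = 1 + (2 * P.gamma) * x + (3 / 2 * P.epsilon) * x ^ 2 + (1 / 2 * P.gammaN 3) * x ^ 3
        + x ^ 4 * β x := by
    filter_upwards [eventually_abs_lt (abs_pos.2 hx₀)] with x hx
    rw [PPN.seriesB, tsum_eq_sum_add_pow_mul hB hx 4]
    simp [Finset.sum_range_succ, PPN.bCoeff, hβd]
  have hA0 : AnalyticAt ℝ P.seriesA 0 := analyticAt_tsum hx₀ hA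
  have hB0 : AnalyticAt ℝ P.seriesB 0 := analyticAt_tsum hx₀ hB
  set α2 : ℝ → ℝ := fun x => -(3 / 2) * P.betaN 3 + x * α x
  set β2 : ℝ → ℝ := fun x => 1 / 2 * P.gammaN 3 + x * β x
  set α1 : ℝ → ℝ := fun x => 4 * α x + x * deriv α x
  set β1 : ℝ → ℝ := fun x => 4 * β x + x * deriv β x
  set cand : ℝ → ℝ := fun x => 1 + P.gamma + 2 * P.kappa * x + 3 * P.kappa3 * x ^ 2
  -- The explicit quotient by `x ^ 3`. It is obtained from the expansions of the two series, with
  -- `α2`, `β2` collecting their terms from degree 3 on and `α1`, `β1` the parts of their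
  -- derivatives of degree at least 3.
  set R : ℝ → ℝ := fun x =>
    ((1 / 2 * (-3 * P.gammaN 3 + 9 * P.gamma * P.betaN 3)
        - ((1 + P.gamma) * (-8 * P.beta) + 2 * P.kappa * (4 + 4 * P.beta) - 12 * P.kappa3))
      + x * (1 / 2 * (3 * P.gammaN 3 * P.beta + 27 / 4 * P.epsilon * P.betaN 3)
        - ((1 + P.gamma) * 4 * P.beta ^ 2 - 16 * P.kappa * P.beta
          + 3 * P.kappa3 * (4 + 4 * P.beta)))
      - x ^ 2 * (8 * P.kappa * P.beta ^ 2 - 24 * P.kappa3 * P.beta)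
      - x ^ 3 * (12 * P.kappa3 * P.beta ^ 2)
      + 1 / 2 * (β1 x * P.seriesA x + (2 * P.gamma + 3 * P.epsilon * x
          + 3 / 2 * P.gammaN 3 * x ^ 2) * α2 x
        - β2 x * deriv P.seriesA x - (1 + 2 * P.gamma * x + 3 / 2 * P.epsilon * x ^ 2) * α1 x)
      - cand x * α2 x * (P.seriesA x + (1 - 2 * x + 2 * P.beta * x ^ 2)))
    / P.seriesA x ^ 2 with hRd
  have hR : ContinuousAt R 0 := by
    have c1 := hA0.continuousAt
    have c2 := hA0.deriv.continuousAt
    have c3 := hα.continuousAt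
    have c4 := hβ.continuousAt
    have c5 := hα.deriv.continuousAt
    have c6 := hβ.deriv.continuousAt
    refine ContinuousAt.div ?_ (c1.pow 2) (by simp [P.seriesA_zero])
    simp only [α1, α2, β1, β2, cand]
    fun_prop
  have hbd : ∀ᶠ x in 𝓝 (0 : ℝ), |R x| ≤ |R 0| + 1 := by
    filter_upwards [hR.abs.eventually (eventually_lt_nhds (lt_add_one |R 0|))] with x hx
    exact hx.le
  have hpos : ∀ᶠ x in 𝓝 (0 : ℝ), P.seriesA x ≠ 0 :=
    hA0.continuousAt.eventually_ne (by simp [P.seriesA_zero])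
  refine ⟨|R 0| + 1, ?_⟩
  filter_upwards [hbd, hpos, eA, eB, eA.eventually_nhds, eB.eventually_nhds,
    hα.eventually_analyticAt, hβ.eventually_analyticAt] with x h1 h2 h3 h4 h5 h6 h7 h8
  have dA := deriv_eq_of_cubic_add h5 h7.differentiableAt
  have dB := deriv_eq_of_cubic_add h6 h8.differentiableAt
  have key : P.force x - cand x = R x * x ^ 3 := by
    simp only [PPN.force, hRd]
    rw [div_sub' (by positivity), div_mul_eq_mul_div, div_eq_div_iff (by positivity) (by positivity)]
    have hk : (P.kappa : ℝ) = 2 * (1 + P.gamma) - P.beta + 3 / 4 * P.epsilon := rfl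
    have hk3 : P.kappa3 = 2 * P.kappa - 2 * P.beta * (1 + P.gamma) + 3 / 4 * P.betaN 3
      + 1 / 4 * P.gammaN 3 := rfl
    have key2 : deriv P.seriesB x * P.seriesA x - P.seriesB x * deriv P.seriesA x
        - 2 * P.seriesA x ^ 2 * cand x = 2 * x ^ 3 * (R x * P.seriesA x ^ 2) := by
      simp only [hRd]
      rw [div_mul_cancel₀ _ (by positivity)]
      simp only [α1, α2, β1, β2, cand]
      rw [dA, dB, h3, h4, hk3, hk]
      ring
    rw [key2, hRd]
    field_simp
  rw [key, abs_mul, abs_pow]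
  exact mul_le_mul_of_nonneg_right h1 (by positivity)

/-- One radius `δ` and one constant `K` serve for the size, the Taylor remainder and the Lipschitz
constant of the force, so that all later estimates share them. -/
theorem PPN.exists_local_bounds {P : PPN} {m₀ rh : ℝ} (hm₀ : 0 < m₀) (hrh : 0 < rh)
    (hreg : P.RegularOutside m₀ rh) :
    ∃ δ > 0, ∃ K > 0, (∀ x, |x| < δ → AnalyticAt ℝ P.seriesA x ∧ AnalyticAt ℝ P.seriesB x ∧
        0 < P.seriesA x ∧ 0 < P.seriesB x ∧ |P.force x| ≤ K ∧
        |P.force x - (1 + P.gamma + 2 * P.kappa * x + 3 * P.kappa3 * x ^ 2)| ≤ K * |x| ^ 3) ∧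
      ∀ x y, |x| < δ → |y| < δ → |P.force x - P.force y| ≤ K * |x - y| := by
  -- Any radius beyond `rh` would do: a single nonzero point of convergence makes both series
  -- analytic at `0`.
  have hx₀ : m₀ / (rh + 1) ≠ 0 := by positivity
  obtain ⟨hA, hB, -, -⟩ := hreg (rh + 1) (by linarith)
  have hA0 : AnalyticAt ℝ P.seriesA 0 := analyticAt_tsum hx₀ hA
  have hB0 : AnalyticAt ℝ P.seriesB 0 := analyticAt_tsum hx₀ hB
  have hF := PPN.analyticAt_force hA0 hB0
  obtain ⟨C, hC⟩ := PPN.force_expansion hx₀ hA hB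
  obtain ⟨L, t, ht, hL⟩ := (hF.contDiffAt (n := 1)).exists_lipschitzOnWith
  have hbd : ∀ᶠ x in 𝓝 (0 : ℝ), |P.force x| ≤ |P.force 0| + 1 := by
    filter_upwards [hF.continuousAt.abs.eventually (eventually_lt_nhds (lt_add_one _))] with x hx
    exact hx.le
  have pA : ∀ᶠ x in 𝓝 (0 : ℝ), 0 < P.seriesA x :=
    hA0.continuousAt.eventually (lt_mem_nhds (by simp [P.seriesA_zero]))
  have pB : ∀ᶠ x in 𝓝 (0 : ℝ), 0 < P.seriesB x :=
    hB0.continuousAt.eventually (lt_mem_nhds (by simp [P.seriesB_zero]))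
  have := ((((((hC.and hbd).and pA).and pB).and hA0.eventually_analyticAt).and
    hB0.eventually_analyticAt).and ht)
  obtain ⟨δ, hδ, h⟩ := Metric.eventually_nhds_iff.1 this
  refine ⟨δ, hδ, |C| + (|P.force 0| + 1) + L, by positivity, fun x hx => ?_, fun x y hx hy => ?_⟩
  · obtain ⟨⟨⟨⟨⟨⟨h1, h2⟩, h3⟩, h4⟩, h5⟩, h6⟩, h7⟩ := h (y := x) (by simpa using hx)
    have hL0 : (0 : ℝ) ≤ L := L.2
    refine ⟨h5, h6, h3, h4, h2.trans ?_, h1.trans ?_⟩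
    · linarith [abs_nonneg C]
    · gcongr
      linarith [le_abs_self C, abs_nonneg (P.force 0)]
  · have h1 := (h (y := x) (by simpa using hx)).2
    have h2 := (h (y := y) (by simpa using hy)).2
    have := hL.dist_le_mul x h1 y h2
    rw [Real.dist_eq, Real.dist_eq] at this
    refine this.trans ?_
    gcongr
    linarith [abs_nonneg C, abs_nonneg (P.force 0)]

/-! ### Perturbed oscillators -/

/-- Variation of constants without integrals: `τ ↦ D τ cos (θ - τ) + D₁ τ sin (θ - τ)` runs from `0`
to `D θ` and has derivative `e τ sin (θ - τ)`, so the mean value theorem gives the bound. -/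
theorem abs_le_mul_of_oscillator {D D₁ e : ℝ → ℝ} {ψ K : ℝ}
    (hD : ContinuousOn D (Set.Icc 0 ψ)) (hD₁ : ContinuousOn D₁ (Set.Icc 0 ψ))
    (h0 : D 0 = 0) (h1 : D₁ 0 = 0)
    (dD : ∀ φ ∈ Set.Ioo 0 ψ, HasDerivAt D (D₁ φ) φ)
    (dD₁ : ∀ φ ∈ Set.Ioo 0 ψ, HasDerivAt D₁ (-D φ + e φ) φ)
    (he : ∀ φ ∈ Set.Ioo 0 ψ, |e φ| ≤ K) {θ : ℝ} (hθ : θ ∈ Set.Icc 0 ψ) : |D θ| ≤ K * θ := by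
  rcases hθ.1.eq_or_lt with rfl | hpos
  · simp [h0]
  have hsub : Set.Icc 0 θ ⊆ Set.Icc 0 ψ := Set.Icc_subset_Icc_right hθ.2
  have hsub' : Set.Ioo 0 θ ⊆ Set.Ioo 0 ψ := Set.Ioo_subset_Ioo_right hθ.2
  obtain ⟨c, hc, hslope⟩ := exists_hasDerivAt_eq_slope
    (fun τ => D τ * Real.cos (θ - τ) + D₁ τ * Real.sin (θ - τ))
    (fun τ => e τ * Real.sin (θ - τ)) hpos
    (((hD.mono hsub).mul (by fun_prop)).add ((hD₁.mono hsub).mul (by fun_prop)))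
    (fun τ hτ => by
      have ha : HasDerivAt (fun τ : ℝ => θ - τ) (-1) τ := by
        simpa using (hasDerivAt_id τ).const_sub θ
      refine (((dD τ (hsub' hτ)).mul ha.cos).add ((dD₁ τ (hsub' hτ)).mul ha.sin)).congr_deriv ?_
      ring)
  simp only [sub_self, Real.cos_zero, Real.sin_zero, h0, h1] at hslope
  have hDθ : D θ = e c * Real.sin (θ - c) * θ := by
    field_simp at hslope
    linarith
  rw [hDθ, abs_mul, abs_of_pos hpos, abs_mul]
  have hs := Real.abs_sin_le_one (θ - c)
  have := he c (hsub' hc)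
  gcongr
  calc |e c| * |Real.sin (θ - c)| ≤ |e c| * 1 := by gcongr
    _ ≤ K := by simpa using this

/-- `w = m / r` as a function of the angle `φ` swept since the emission at infinity, with
derivative `ω`, on a ray with `m / b = μ` that sweeps the angle `ψ`. -/
structure IsOrbit (G : ℝ → ℝ) (μ ψ η : ℝ) (w ω : ℝ → ℝ) : Prop where
  cont : ContinuousOn w (Set.Icc 0 ψ)
  cont_deriv : ContinuousOn ω (Set.Icc 0 ψ)
  zero : w 0 = 0
  deriv_zero : ω 0 = μ
  hasDerivAt : ∀ φ ∈ Set.Ioo 0 ψ, HasDerivAt w (ω φ) φ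
  hasDerivAt_deriv : ∀ φ ∈ Set.Ioo 0 ψ, HasDerivAt ω (-w φ + μ ^ 2 * G (w φ)) φ
  mem : ∀ φ ∈ Set.Icc 0 ψ, w φ ∈ Set.Icc 0 η

theorem IsOrbit.abs_sub_le {G w ω W W₁ e : ℝ → ℝ} {μ ψ η K : ℝ} (h : IsOrbit G μ ψ η w ω)
    (hψ : 0 < ψ) (hψπ : ψ ≤ Real.pi)
    (dW : ∀ φ, HasDerivAt W (W₁ φ) φ) (dW₁ : ∀ φ, HasDerivAt W₁ (-W φ + e φ) φ)
    (hW : W 0 = 0) (hW₁ : W₁ 0 = μ)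
    (he : ∀ φ ∈ Set.Icc 0 ψ, |μ ^ 2 * G (w φ) - e φ| ≤ K) :
    ∀ θ ∈ Set.Icc 0 ψ, |w θ - W θ| ≤ K * Real.pi := by
  intro θ hθ
  have hWc : Continuous W := continuous_iff_continuousAt.2 fun φ => (dW φ).continuousAt
  have hW₁c : Continuous W₁ := continuous_iff_continuousAt.2 fun φ => (dW₁ φ).continuousAt
  have := abs_le_mul_of_oscillator (D := fun φ => w φ - W φ) (D₁ := fun φ => ω φ - W₁ φ)
    (e := fun φ => μ ^ 2 * G (w φ) - e φ) (K := K)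
    (h.cont.sub hWc.continuousOn) (h.cont_deriv.sub hW₁c.continuousOn)
    (by simp [h.zero, hW]) (by simp [h.deriv_zero, hW₁])
    (fun φ hφ => (h.hasDerivAt φ hφ).sub (dW φ))
    (fun φ hφ => ((h.hasDerivAt_deriv φ hφ).sub (dW₁ φ)).congr_deriv (by ring))
    (fun φ hφ => he φ (Set.Ioo_subset_Icc_self hφ)) hθ
  have hK : 0 ≤ K := (abs_nonneg _).trans (he 0 ⟨le_rfl, hψ.le⟩)
  refine this.trans ?_
  gcongr
  exact hθ.2.trans hψπ

/-- The first four orders in `μ` of `m / r` on a ray that has swept the angle `φ`. -/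
noncomputable def orbitPoly (g₀ g₁ g₂ φ μ : ℝ) : ℝ :=
  μ * Real.sin φ + μ ^ 2 * (g₀ * (1 - Real.cos φ))
    + μ ^ 3 * (g₁ / 2 * (Real.sin φ - φ * Real.cos φ))
    + μ ^ 4 * (g₀ * g₁ * (1 - Real.cos φ - φ * Real.sin φ / 2)
      + g₂ / 3 * (1 - Real.cos φ) ^ 2)

/-- With the next lemma, this shows that `orbitPoly` solves the oscillator exactly for a truncated
forcing. As the forcing carries a factor `μ ^ 2`, second-order accuracy inside it gives fourth-order
accuracy outside. -/
theorem hasDerivAt_orbitPoly (g₀ g₁ g₂ μ φ : ℝ) :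
    HasDerivAt (fun φ => orbitPoly g₀ g₁ g₂ φ μ)
      (μ * Real.cos φ + μ ^ 2 * (g₀ * Real.sin φ) + μ ^ 3 * (g₁ / 2 * (φ * Real.sin φ))
        + μ ^ 4 * (g₀ * g₁ * (Real.sin φ / 2 - φ * Real.cos φ / 2)
          + g₂ / 3 * (2 * (1 - Real.cos φ) * Real.sin φ))) φ := by
  have s := Real.hasDerivAt_sin φ
  have c := Real.hasDerivAt_cos φ
  have i := hasDerivAt_id' φ
  refine ((((s.const_mul μ).add (((c.const_sub 1).const_mul g₀).const_mul (μ ^ 2))).add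
    (((s.sub (i.mul c)).const_mul (g₁ / 2)).const_mul (μ ^ 3))).add
    (((((c.const_sub 1).sub ((i.mul s).div_const 2)).const_mul (g₀ * g₁)).add
      (((c.const_sub 1).pow 2).const_mul (g₂ / 3))).const_mul (μ ^ 4))).congr_deriv ?_
  simp only [Nat.cast_ofNat]
  ring

theorem hasDerivAt_orbitPoly_deriv (g₀ g₁ g₂ μ φ : ℝ) :
    HasDerivAt (fun φ => μ * Real.cos φ + μ ^ 2 * (g₀ * Real.sin φ)
        + μ ^ 3 * (g₁ / 2 * (φ * Real.sin φ))
        + μ ^ 4 * (g₀ * g₁ * (Real.sin φ / 2 - φ * Real.cos φ / 2)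
          + g₂ / 3 * (2 * (1 - Real.cos φ) * Real.sin φ)))
      (-orbitPoly g₀ g₁ g₂ φ μ + μ ^ 2 * (g₀ + g₁ * (μ * Real.sin φ
        + μ ^ 2 * (g₀ * (1 - Real.cos φ))) + g₂ * (μ * Real.sin φ) ^ 2)) φ := by
  have s := Real.hasDerivAt_sin φ
  have c := Real.hasDerivAt_cos φ
  have i := hasDerivAt_id' φ
  refine ((((c.const_mul μ).add ((s.const_mul g₀).const_mul (μ ^ 2))).add
    (((i.mul s).const_mul (g₁ / 2)).const_mul (μ ^ 3))).add
    (((((s.div_const 2).sub ((i.mul c).div_const 2)).const_mul (g₀ * g₁)).add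
      ((((c.const_sub 1).const_mul 2).mul s).const_mul (g₂ / 3))).const_mul
        (μ ^ 4))).congr_deriv ?_
  simp [orbitPoly]
  have := Real.sin_sq_add_cos_sq φ
  linear_combination (-(μ ^ 4 * g₂ / 3)) * this

/-- Bootstrap by Picard iteration: the crude bound on `G` gives `w = μ sin φ + O(μ²)`, this gives
`w` up to `O(μ³)`, and these two approximations determine the forcing well enough to reach `O(μ⁵)`,
with no separate cubic stage. -/
theorem exists_orbit_expansion {G : ℝ → ℝ} {δ K g₀ g₁ g₂ : ℝ} (hK : 0 < K)
    (hG : ∀ x, |x| < δ → |G x| ≤ K)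
    (hG3 : ∀ x, |x| < δ → |G x - (g₀ + g₁ * x + g₂ * x ^ 2)| ≤ K * |x| ^ 3) :
    ∃ C, ∀ μ ψ η w ω, 0 < μ → μ ≤ 1 → 0 < ψ → ψ ≤ Real.pi → η < δ → IsOrbit G μ ψ η w ω →
      |w ψ - orbitPoly g₀ g₁ g₂ ψ μ| ≤ C * μ ^ 5 := by
  have hπ := Real.pi_pos
  -- The constants are chosen so that `w ≤ M μ`, `|G w - g₀| ≤ L w`, and the error of the truncated
  -- forcing is at most `N μ ^ 5`.
  set M : ℝ := 1 + K * Real.pi with hM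
  have hM1 : 1 ≤ M := by rw [hM]; linarith [mul_pos hK hπ]
  set L : ℝ := |g₁| + |g₂| * M + K * M ^ 2 with hL
  have hL0 : 0 ≤ L := by positivity
  set N : ℝ := K * M ^ 3 + |g₁| * (L * M * Real.pi) + |g₂| * ((M + 1) * (K * Real.pi)) with hN
  refine ⟨N * Real.pi, fun μ ψ η w ω hμ hμ1 hψ hψπ hη h => ?_⟩
  have hw0 : ∀ φ ∈ Set.Icc 0 ψ, 0 ≤ w φ := fun φ hφ => (h.mem φ hφ).1
  have hwδ : ∀ φ ∈ Set.Icc 0 ψ, |w φ| < δ := fun φ hφ => by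
    rw [abs_of_nonneg (hw0 φ hφ)]
    exact (h.mem φ hφ).2.trans_lt hη
  have b1 : ∀ φ ∈ Set.Icc 0 ψ, |w φ - μ * Real.sin φ| ≤ μ ^ 2 * K * Real.pi := by
    refine h.abs_sub_le (W := fun φ => μ * Real.sin φ) (W₁ := fun φ => μ * Real.cos φ)
      (e := fun _ => 0) hψ hψπ (fun φ => (Real.hasDerivAt_sin φ).const_mul μ)
      (fun φ => ((Real.hasDerivAt_cos φ).const_mul μ).congr_deriv (by ring)) (by simp) (by simp)
      fun φ hφ => ?_
    rw [sub_zero, abs_mul, abs_of_nonneg (by positivity)]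
    gcongr
    exact hG _ (hwδ φ hφ)
  have hsin : ∀ φ, |μ * Real.sin φ| ≤ μ := fun φ => by
    rw [abs_mul, abs_of_pos hμ]
    exact mul_le_of_le_one_right hμ.le (Real.abs_sin_le_one φ)
  have hwM : ∀ φ ∈ Set.Icc 0 ψ, w φ ≤ M * μ := fun φ hφ => by
    have h1 := (abs_le.1 (b1 φ hφ)).2
    have h2 := (abs_le.1 (hsin φ)).2
    have h3 : μ ^ 2 * K * Real.pi ≤ μ * K * Real.pi := by
      gcongr
      nlinarith
    rw [hM]
    linarith
  have b2 : ∀ φ ∈ Set.Icc 0 ψ, |w φ - (μ * Real.sin φ + μ ^ 2 * (g₀ * (1 - Real.cos φ)))|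
      ≤ μ ^ 2 * (L * (M * μ)) * Real.pi := by
    refine h.abs_sub_le (W := fun φ => μ * Real.sin φ + μ ^ 2 * (g₀ * (1 - Real.cos φ)))
      (W₁ := fun φ => μ * Real.cos φ + μ ^ 2 * (g₀ * Real.sin φ))
      (e := fun _ => μ ^ 2 * g₀) hψ hψπ
      (fun φ => (((Real.hasDerivAt_sin φ).const_mul μ).add
        ((((Real.hasDerivAt_cos φ).const_sub 1).const_mul g₀).const_mul (μ ^ 2))).congr_deriv
          (by ring))
      (fun φ => (((Real.hasDerivAt_cos φ).const_mul μ).add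
        (((Real.hasDerivAt_sin φ).const_mul g₀).const_mul (μ ^ 2))).congr_deriv (by ring))
      (by simp) (by simp) fun φ hφ => ?_
    rw [← mul_sub, abs_mul, abs_of_nonneg (sq_nonneg μ)]
    gcongr
    have h1 := hG3 _ (hwδ φ hφ)
    have h0 := hw0 φ hφ
    have h2 : w φ ≤ M := (hwM φ hφ).trans (mul_le_of_le_one_right (by linarith) hμ1)
    rw [abs_of_nonneg h0] at h1
    calc |G (w φ) - g₀| = |(G (w φ) - (g₀ + g₁ * w φ + g₂ * w φ ^ 2))
          + (g₁ * w φ + g₂ * w φ ^ 2)| := by congr 1; ring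
      _ ≤ K * w φ ^ 3 + (|g₁| * w φ + |g₂| * w φ ^ 2) := by
        refine (abs_add_le _ _).trans (add_le_add h1 ((abs_add_le _ _).trans ?_))
        rw [abs_mul, abs_mul, abs_pow, abs_of_nonneg h0]
      _ = (|g₁| + |g₂| * w φ + K * w φ ^ 2) * w φ := by ring
      _ ≤ L * (M * μ) := by
        rw [hL]
        gcongr
        exact hwM φ hφ
  have b3 := h.abs_sub_le (K := N * μ ^ 5) (W := fun φ => orbitPoly g₀ g₁ g₂ φ μ)
    hψ hψπ (hasDerivAt_orbitPoly g₀ g₁ g₂ μ) (hasDerivAt_orbitPoly_deriv g₀ g₁ g₂ μ)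
    (by simp [orbitPoly]) (by simp) (fun φ hφ => by
      rw [← mul_sub, abs_mul, abs_of_nonneg (sq_nonneg μ)]
      have h1 := hG3 _ (hwδ φ hφ)
      have h0 := hw0 φ hφ
      have h2 := b2 φ hφ
      have h3 := b1 φ hφ
      have h4 := hwM φ hφ
      rw [abs_of_nonneg h0] at h1
      set S := μ * Real.sin φ
      set W := S + μ ^ 2 * (g₀ * (1 - Real.cos φ))
      have h5 : |w φ + S| ≤ (M + 1) * μ := by
        refine (abs_add_le _ _).trans ?_
        rw [abs_of_nonneg h0, add_mul, one_mul]
        exact add_le_add h4 (hsin φ)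
      have key : |G (w φ) - (g₀ + g₁ * W + g₂ * S ^ 2)| ≤ N * μ ^ 3 := by
        calc |G (w φ) - (g₀ + g₁ * W + g₂ * S ^ 2)|
            = |(G (w φ) - (g₀ + g₁ * w φ + g₂ * w φ ^ 2)) + (g₁ * (w φ - W)
              + g₂ * ((w φ + S) * (w φ - S)))| := by congr 1; ring
          _ ≤ K * w φ ^ 3 + (|g₁| * |w φ - W| + |g₂| * (|w φ + S| * |w φ - S|)) := by
            refine (abs_add_le _ _).trans (add_le_add h1 ((abs_add_le _ _).trans ?_))
            rw [abs_mul, abs_mul, abs_mul]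
          _ ≤ K * (M * μ) ^ 3 + (|g₁| * (μ ^ 2 * (L * (M * μ)) * Real.pi)
              + |g₂| * (((M + 1) * μ) * (μ ^ 2 * K * Real.pi))) := by
            gcongr
          _ = N * μ ^ 3 := by rw [hN]; ring
      calc μ ^ 2 * |G (w φ) - (g₀ + g₁ * W + g₂ * S ^ 2)| ≤ μ ^ 2 * (N * μ ^ 3) := by gcongr
        _ = N * μ ^ 5 := by ring)
  refine (b3 ψ ⟨hψ.le, le_rfl⟩).trans (le_of_eq ?_)
  ring

/-- The difference of two orbits is `(μ - μ') sin φ` up to a small multiple of `|μ - μ'|`. Since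
`sin ψ > 0`, equal end values force `μ = μ'`. -/
theorem exists_orbit_unique {G : ℝ → ℝ} {δ K ψ : ℝ} (hK : 0 < K)
    (hG : ∀ x, |x| < δ → |G x| ≤ K)
    (hL : ∀ x y, |x| < δ → |y| < δ → |G x - G y| ≤ K * |x - y|)
    (hψ : 0 < ψ) (hψπ : ψ < Real.pi) :
    ∃ μ₀ > 0, ∀ μ μ' η w ω w' ω', 0 < μ → μ < μ₀ → 0 < μ' → μ' < μ₀ → η < δ →
      IsOrbit G μ ψ η w ω → IsOrbit G μ' ψ η w' ω' → w ψ = w' ψ → μ = μ' := by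
  have hπ := Real.pi_pos
  have hs : 0 < Real.sin ψ := Real.sin_pos_of_pos_of_lt_pi hψ hψπ
  have hs1 := Real.sin_le_one ψ
  -- The factor 6 first yields `B ≤ 2 |μ - μ'|` for the maximal distance `B` of the orbits, then an
  -- error at `ψ` of at most two thirds of `|μ - μ'| sin ψ`.
  set μ₀ : ℝ := min 1 (Real.sin ψ / (6 * K * Real.pi))
  have hμ₀ : 0 < μ₀ := by positivity
  refine ⟨μ₀, hμ₀, fun μ μ' η w ω w' ω' hμ hμ0 hμ' hμ0' hη h h' heq => ?_⟩
  have hsmall : 6 * K * Real.pi * μ₀ ≤ Real.sin ψ := by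
    have : μ₀ ≤ Real.sin ψ / (6 * K * Real.pi) := min_le_right _ _
    rw [le_div_iff₀ (by positivity)] at this
    linarith
  have hμ₀1 : μ₀ ≤ 1 := min_le_left _ _
  have hab : ∀ φ ∈ Set.Icc 0 ψ, |w φ| < δ ∧ |w' φ| < δ := fun φ hφ => by
    rw [abs_of_nonneg (h.mem φ hφ).1, abs_of_nonneg (h'.mem φ hφ).1]
    exact ⟨(h.mem φ hφ).2.trans_lt hη, (h'.mem φ hφ).2.trans_lt hη⟩
  obtain ⟨φ₀, hφ₀, hmax⟩ := isCompact_Icc.exists_isMaxOn (Set.nonempty_Icc.2 hψ.le)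
    (h.cont.sub h'.cont).abs
  set B : ℝ := |w φ₀ - w' φ₀| with hB
  have hBmax : ∀ φ ∈ Set.Icc 0 ψ, |w φ - w' φ| ≤ B := fun φ hφ => hmax hφ
  have hB0 : 0 ≤ B := abs_nonneg _
  set E : ℝ := K * (2 * μ₀ * |μ - μ'| + μ₀ * B) with hE
  have hE0 : 0 ≤ E := by positivity
  have hbound : ∀ θ ∈ Set.Icc 0 ψ,
      |w θ - w' θ - (μ - μ') * Real.sin θ| ≤ E * Real.pi := by
    intro θ hθ
    have := abs_le_mul_of_oscillator
      (D := fun φ => w φ - w' φ - (μ - μ') * Real.sin φ)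
      (D₁ := fun φ => ω φ - ω' φ - (μ - μ') * Real.cos φ)
      (e := fun φ => μ ^ 2 * G (w φ) - μ' ^ 2 * G (w' φ)) (K := E)
      ((h.cont.sub h'.cont).sub (by fun_prop)) ((h.cont_deriv.sub h'.cont_deriv).sub (by fun_prop))
      (by simp [h.zero, h'.zero]) (by simp [h.deriv_zero, h'.deriv_zero])
      (fun φ hφ => ((h.hasDerivAt φ hφ).sub (h'.hasDerivAt φ hφ)).sub
        ((Real.hasDerivAt_sin φ).const_mul _))
      (fun φ hφ => (((h.hasDerivAt_deriv φ hφ).sub (h'.hasDerivAt_deriv φ hφ)).sub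
        ((Real.hasDerivAt_cos φ).const_mul _)).congr_deriv (by ring))
      (fun φ hφ => by
        have hφ' := Set.Ioo_subset_Icc_self hφ
        have h1 := hG _ (hab φ hφ').1
        have h2 := hL _ _ (hab φ hφ').1 (hab φ hφ').2
        have h3 := hBmax φ hφ'
        calc |μ ^ 2 * G (w φ) - μ' ^ 2 * G (w' φ)|
            = |(μ + μ') * (μ - μ') * G (w φ) + μ' ^ 2 * (G (w φ) - G (w' φ))| := by
              congr 1; ring
          _ ≤ (μ + μ') * |μ - μ'| * |G (w φ)| + μ' ^ 2 * |G (w φ) - G (w' φ)| := by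
              refine (abs_add_le _ _).trans (le_of_eq ?_)
              rw [abs_mul, abs_mul, abs_mul, abs_of_pos (add_pos hμ hμ'),
                abs_of_pos (pow_pos hμ' 2)]
          _ ≤ (μ₀ + μ₀) * |μ - μ'| * K + μ₀ * (K * B) := by
              gcongr
              · nlinarith
              · exact h2.trans (by gcongr)
          _ = E := by rw [hE]; ring) hθ
    refine this.trans ?_
    gcongr
    exact hθ.2.trans hψπ.le
  have hBle : B ≤ |μ - μ'| + E * Real.pi := by
    have h1 := hbound φ₀ hφ₀
    calc B = |(w φ₀ - w' φ₀ - (μ - μ') * Real.sin φ₀) + (μ - μ') * Real.sin φ₀| := by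
          rw [hB]; congr 1; ring
      _ ≤ E * Real.pi + |μ - μ'| * 1 := by
          refine (abs_add_le _ _).trans (add_le_add h1 ?_)
          rw [abs_mul]
          gcongr
          exact Real.abs_sin_le_one _
      _ = _ := by ring
  have hend := hbound ψ ⟨hψ.le, le_rfl⟩
  rw [heq, sub_self, zero_sub, abs_neg, abs_mul, abs_of_pos hs] at hend
  have hK6 : K * Real.pi * μ₀ ≤ 1 / 6 * Real.sin ψ := by linarith
  have hEπ : E * Real.pi ≤ 1 / 6 * Real.sin ψ * (2 * |μ - μ'| + B) := by
    calc E * Real.pi = (K * Real.pi * μ₀) * (2 * |μ - μ'| + B) := by rw [hE]; ring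
      _ ≤ _ := by gcongr
  have hB2 : B ≤ 2 * |μ - μ'| := by
    have : 1 / 6 * Real.sin ψ * (2 * |μ - μ'| + B) ≤ 1 / 6 * 1 * (2 * |μ - μ'| + B) := by gcongr
    linarith [abs_nonneg (μ - μ')]
  have hfin : |μ - μ'| * Real.sin ψ ≤ 1 / 6 * Real.sin ψ * (4 * |μ - μ'|) := by
    refine hend.trans (hEπ.trans ?_)
    gcongr
    linarith
  have : |μ - μ'| ≤ 0 := by
    by_contra hne
    push Not at hne
    nlinarith [mul_pos hne hs]
  exact sub_eq_zero.1 (abs_nonpos_iff.1 this)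

/-! ### Change of parameter -/

theorem abs_sub_le_of_abs_deriv_le {f f' Φ g : ℝ → ℝ} {c : ℝ}
    (hf : ∀ s ≤ 0, HasDerivWithinAt f (f' s) (Set.Iic 0) s)
    (hΦ : ∀ s, HasDerivAt Φ (g s) s) (hb : ∀ s ≤ 0, |f' s| ≤ c * g s)
    {a b : ℝ} (hab : a ≤ b) (hb0 : b ≤ 0) : |f b - f a| ≤ c * (Φ b - Φ a) := by
  have hfd : ∀ s < 0, HasDerivAt f (f' s) s := fun s hs =>
    (hf s hs.le).hasDerivAt (Iic_mem_nhds hs)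
  have hΦc : ContinuousOn Φ (Set.Iic 0) := fun s _ => (hΦ s).continuousAt.continuousWithinAt
  have hfc : ContinuousOn f (Set.Iic 0) := fun s hs => (hf s hs).continuousWithinAt
  have m1 : MonotoneOn (fun s => c * Φ s - f s) (Set.Iic 0) := by
    refine monotoneOn_of_hasDerivWithinAt_nonneg (f' := fun s => c * g s - f' s) (convex_Iic 0)
      ((continuousOn_const.mul hΦc).sub hfc) ?_ ?_
    · intro s hs
      rw [interior_Iic] at hs
      exact (((hΦ s).const_mul c).sub (hfd s hs)).hasDerivWithinAt
    · intro s hs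
      rw [interior_Iic] at hs
      have := (abs_le.1 (hb s (le_of_lt hs))).2
      simpa using this
  have m2 : MonotoneOn (fun s => c * Φ s + f s) (Set.Iic 0) := by
    refine monotoneOn_of_hasDerivWithinAt_nonneg (f' := fun s => c * g s + f' s) (convex_Iic 0)
      ((continuousOn_const.mul hΦc).add hfc) ?_ ?_
    · intro s hs
      rw [interior_Iic] at hs
      exact (((hΦ s).const_mul c).add (hfd s hs)).hasDerivWithinAt
    · intro s hs
      rw [interior_Iic] at hs
      have := (abs_le.1 (hb s (le_of_lt hs))).1
      linarith
  have h1 := m1 (Set.mem_Iic.2 (hab.trans hb0)) (Set.mem_Iic.2 hb0) hab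
  have h2 := m2 (Set.mem_Iic.2 (hab.trans hb0)) (Set.mem_Iic.2 hb0) hab
  simp only at h1 h2
  rw [abs_le]
  constructor <;> linarith

theorem eq_of_hasDerivWithinAt_zero {f : ℝ → ℝ}
    (hf : ∀ s ≤ 0, HasDerivWithinAt f 0 (Set.Iic 0) s) {s : ℝ} (hs : s ≤ 0) : f s = f 0 := by
  have := abs_sub_le_of_abs_deriv_le (c := 0) (f' := fun _ => 0) (g := fun _ => 1) hf
    (fun s => hasDerivAt_id' s) (by simp) hs le_rfl
  rw [zero_mul] at this
  exact (sub_eq_zero.1 (abs_nonpos_iff.1 this)).symm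

/-- This exchanges the affine parameter for the swept angle `φ`; the emission at infinity becomes
the endpoint `φ = 0`, which no finite parameter reaches. -/
theorem exists_inverse_parameter {φ g : ℝ → ℝ} {Δ : ℝ} (hd : ∀ s, HasDerivAt φ (g s) s)
    (hg : ∀ s, 0 < g s) (h0 : φ 0 = Δ) (hlim : Tendsto φ atBot (𝓝 0)) :
    ∃ σ : ℝ → ℝ, σ Δ = 0 ∧ (∀ y ∈ Set.Ioo 0 Δ, σ y < 0 ∧ HasDerivAt σ (g (σ y))⁻¹ y) ∧
      ContinuousAt σ Δ ∧ Tendsto σ (𝓝[>] 0) atBot := by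
  have hmono : StrictMono φ := strictMono_of_hasDerivAt_pos hd hg
  have hcont : Continuous φ := continuous_iff_continuousAt.2 fun s => (hd s).continuousAt
  have hpos : ∀ s, 0 < φ s := fun s => by
    have h1 : φ (s - 1) < φ s := hmono (by linarith)
    have h2 : 0 ≤ φ (s - 1) := le_of_tendsto hlim <| by
      filter_upwards [eventually_le_atBot (s - 1)] with t ht using hmono.monotone ht
    linarith
  set σ : ℝ → ℝ := Function.invFun φ
  have hσ : ∀ s, σ (φ s) = s := Function.leftInverse_invFun hmono.injective
  have hrange : ∀ t, Set.range φ ∈ 𝓝 (φ t) := fun t => by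
    refine mem_of_superset (Icc_mem_nhds (hmono (sub_one_lt t)) (hmono (lt_add_one t))) ?_
    exact (intermediate_value_Icc (by linarith) hcont.continuousOn).trans (Set.image_subset_range _ _)
  have hσmono : StrictMonoOn σ (Set.range φ) := by
    rintro _ ⟨a, rfl⟩ _ ⟨b, rfl⟩ hab
    rw [hσ, hσ]
    exact hmono.lt_iff_lt.1 hab
  have hσcont : ∀ t, ContinuousAt σ (φ t) := fun t => by
    refine hσmono.continuousAt_of_image_mem_nhds (hrange t) ?_
    refine mem_of_superset univ_mem fun s _ => ⟨φ s, ⟨s, rfl⟩, hσ s⟩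
  have hex : ∀ y ∈ Set.Ioo 0 Δ, ∃ s < 0, φ s = y := fun y hy => by
    obtain ⟨t, ht, ht0⟩ := ((hlim.eventually (gt_mem_nhds hy.1)).and
      (eventually_le_atBot 0)).exists
    obtain ⟨s, hs, hsy⟩ := intermediate_value_Icc ht0 hcont.continuousOn
      (show y ∈ Set.Icc (φ t) (φ 0) from ⟨ht.le, by rw [h0]; exact hy.2.le⟩)
    refine ⟨s, lt_of_le_of_ne hs.2 ?_, hsy⟩
    rintro rfl
    exact hy.2.ne (hsy.symm.trans h0)
  refine ⟨σ, by rw [← h0, hσ], fun y hy => ?_, by rw [← h0]; exact hσcont 0, ?_⟩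
  · obtain ⟨s, hs, rfl⟩ := hex y hy
    refine ⟨by rwa [hσ], ?_⟩
    rw [hσ]
    refine HasDerivAt.of_local_left_inverse (hσcont s) (by rw [hσ]; exact hd s) (hg s).ne' ?_
    filter_upwards [hrange s] with y hy
    obtain ⟨t, rfl⟩ := hy
    rw [hσ]
  · rw [tendsto_atBot]
    intro M
    filter_upwards [Ioo_mem_nhdsGT (lt_min (hpos M) (h0 ▸ hpos 0 : 0 < Δ))] with y hy
    obtain ⟨s, hs, rfl⟩ := hex y ⟨hy.1, hy.2.trans_le (min_le_right _ _)⟩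
    rw [hσ]
    exact (hmono.lt_iff_lt.1 (hy.2.trans_le (min_le_left _ _))).le

/-- At the angle `0` the function has to be given its limit at infinity by hand; elsewhere it is an
ordinary composition. -/
theorem continuousOn_update_comp {f σ : ℝ → ℝ} {Δ l : ℝ} (hΔ : 0 < Δ)
    (hf : ContinuousOn f (Set.Iic 0)) (hl : Tendsto f atBot (𝓝 l)) (h0 : σ Δ = 0)
    (hneg : ∀ y ∈ Set.Ioo 0 Δ, σ y < 0 ∧ ContinuousAt σ y) (hΔc : ContinuousAt σ Δ)
    (hbot : Tendsto σ (𝓝[>] 0) atBot) :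
    ContinuousOn (Function.update (f ∘ σ) 0 l) (Set.Icc 0 Δ) := by
  intro y hy
  rcases hy.1.eq_or_lt with rfl | hpos
  · rw [continuousWithinAt_update_same]
    exact (hl.comp hbot).mono_left (nhdsWithin_mono _ fun y hy => lt_of_le_of_ne hy.1.1 (Ne.symm hy.2))
  · rw [continuousWithinAt_update_of_ne hpos.ne']
    have hσ : ContinuousAt σ y ∧ σ y ≤ 0 := by
      rcases hy.2.eq_or_lt with rfl | hlt
      · exact ⟨hΔc, h0.le⟩
      · exact ⟨(hneg y ⟨hpos, hlt⟩).2, (hneg y ⟨hpos, hlt⟩).1.le⟩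
    have hIoc : ContinuousWithinAt (f ∘ σ) (Set.Ioc 0 Δ) y := by
      refine (hf (σ y) hσ.2).comp hσ.1.continuousWithinAt fun z hz => ?_
      rcases hz.2.eq_or_lt with rfl | hlt
      · exact h0.le
      · exact (hneg z ⟨hz.1, hlt⟩).1.le
    refine hIoc.mono_of_mem_nhdsWithin ?_
    filter_upwards [self_mem_nhdsWithin, mem_nhdsWithin_of_mem_nhds (lt_mem_nhds hpos)] with z h1 h2
    exact ⟨h2, h1.2⟩

/-- Here `g` is the angular velocity, and `C`, `T` are the radial and transverse components of the
direction of emission, which rotate rigidly with the angle. A Sturm-type comparison bounds the total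
angle by `π`; the limit `C → -1` at infinity then identifies its cosine. -/
theorem exists_orbit_of_sweep {G g w ω C T : ℝ → ℝ} {μ η K : ℝ} (hgc : Continuous g)
    (hg : ∀ s, 0 < g s)
    (dw : ∀ s ≤ 0, HasDerivWithinAt w (g s * ω s) (Set.Iic 0) s)
    (dω : ∀ s ≤ 0, HasDerivWithinAt ω (g s * (-w s + μ ^ 2 * G (w s))) (Set.Iic 0) s)
    (dC : ∀ s ≤ 0, HasDerivWithinAt C (g s * T s) (Set.Iic 0) s)
    (dT : ∀ s ≤ 0, HasDerivWithinAt T (-(g s * C s)) (Set.Iic 0) s)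
    (hw : ∀ s ≤ 0, 0 < w s ∧ w s ≤ η) (hη : 0 ≤ η) (hG : ∀ s ≤ 0, |G (w s)| ≤ K)
    (lw : Tendsto w atBot (𝓝 0)) (lω : Tendsto ω atBot (𝓝 μ)) (lC : Tendsto C atBot (𝓝 (-1)))
    (hCT : ∀ s ≤ 0, C s ^ 2 + T s ^ 2 ≤ 1) (hsmall : μ ^ 2 * K * Real.pi < w 0) :
    ∃ ψ w' ω', 0 < ψ ∧ ψ ≤ Real.pi ∧ Real.cos ψ = -C 0 ∧ IsOrbit G μ ψ η w' ω' ∧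
      w' ψ = w 0 := by
  set Φ : ℝ → ℝ := fun s => ∫ t in (0 : ℝ)..s, g t with hΦd
  have dΦ : ∀ s, HasDerivAt Φ (g s) s := fun s => (hgc.integral_hasStrictDerivAt 0 s).hasDerivAt
  have hΦ0 : Φ 0 = 0 := by simp [hΦd]
  have hmono : StrictMono Φ := strictMono_of_hasDerivAt_pos dΦ hg
  have hΦc : Continuous Φ := continuous_iff_continuousAt.2 fun s => (dΦ s).continuousAt
  have hπ := Real.pi_pos
  have hbelow : ∀ s, -Real.pi ≤ Φ s := by
    intro s
    by_contra! hlt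
    have hs0 : s ≤ 0 := by
      by_contra! h
      have := hmono h
      linarith
    obtain ⟨a, ha, haπ⟩ := intermediate_value_Icc hs0 hΦc.continuousOn
      (show -Real.pi ∈ Set.Icc (Φ s) (Φ 0) from ⟨hlt.le, by linarith⟩)
    -- If the angle `π` were swept from `a` on, this Wronskian with the free oscillator would rise
    -- from `-w a` to `w 0`, while the forcing allows a change of at most `μ ^ 2 * K * π < w 0`.
    have := abs_sub_le_of_abs_deriv_le (f := fun s => w s * Real.cos (Φ s) - ω s * Real.sin (Φ s))
      (f' := fun s => -(g s * μ ^ 2 * G (w s) * Real.sin (Φ s))) (c := μ ^ 2 * K)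
      (fun s hs => by
        have hΦw := (dΦ s).hasDerivWithinAt (s := Set.Iic 0)
        refine (((dw s hs).mul hΦw.cos).sub ((dω s hs).mul hΦw.sin)).congr_deriv ?_
        ring) dΦ
      (fun s hs => by
        rw [abs_neg, abs_mul, abs_mul, abs_mul, abs_of_pos (hg s), abs_of_nonneg (sq_nonneg μ)]
        have h1 := hG s hs
        have h2 := Real.abs_sin_le_one (Φ s)
        have h3 := (hg s).le
        have hK : 0 ≤ K := (abs_nonneg _).trans h1
        calc g s * μ ^ 2 * |G (w s)| * |Real.sin (Φ s)| ≤ g s * μ ^ 2 * K * 1 := by gcongr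
          _ = μ ^ 2 * K * g s := by ring) ha.2 le_rfl
    have := (abs_le.1 this).2
    simp only [hΦ0, haπ, Real.cos_zero, Real.sin_zero, Real.cos_neg, Real.sin_neg, Real.cos_pi,
      Real.sin_pi] at this
    have := (hw a ha.2).1
    linarith
  have hbdd : BddBelow (Set.range Φ) := ⟨-Real.pi, by rintro _ ⟨s, rfl⟩; exact hbelow s⟩
  set Δ : ℝ := -⨅ s, Φ s with hΔd
  have lΦ : Tendsto Φ atBot (𝓝 (-Δ)) := by
    rw [hΔd, neg_neg]
    exact tendsto_atBot_ciInf hmono.monotone hbdd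
  have hΔπ : Δ ≤ Real.pi := by
    have := le_ciInf hbelow
    linarith
  have hΔ0 : 0 < Δ := by
    have h1 : ⨅ s, Φ s ≤ Φ (-1) := ciInf_le hbdd _
    have h2 : Φ (-1) < Φ 0 := hmono (by norm_num)
    linarith
  set φ : ℝ → ℝ := fun s => Φ s + Δ with hφd
  have dφ : ∀ s, HasDerivAt φ (g s) s := fun s => (dΦ s).add_const Δ
  have lφ : Tendsto φ atBot (𝓝 0) := by simpa using lΦ.add_const Δ
  have hφ0 : φ 0 = Δ := by simp [hφd, hΦ0]
  have lcos : Tendsto (fun s => Real.cos (φ s)) atBot (𝓝 1) := by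
    exact (Real.continuous_cos.tendsto' 0 1 Real.cos_zero).comp lφ
  have lsin : Tendsto (fun s => Real.sin (φ s)) atBot (𝓝 0) := by
    exact (Real.continuous_sin.tendsto' 0 0 Real.sin_zero).comp lφ
  -- Only the inequality `C² + T² ≤ 1` is needed: `C² → 1` leaves no room for `T`.
  have lT : Tendsto T atBot (𝓝 0) := by
    have h1 : Tendsto (fun s => 1 - C s ^ 2) atBot (𝓝 0) := by
      simpa using (lC.pow 2).const_sub 1
    have h2 : Tendsto (fun s => T s ^ 2) atBot (𝓝 0) := by
      refine squeeze_zero' (Eventually.of_forall fun s => sq_nonneg _) ?_ h1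
      filter_upwards [eventually_le_atBot 0] with s hs
      linarith [hCT s hs]
    have h3 := h2.sqrt
    simp only [Real.sqrt_sq_eq_abs, Real.sqrt_zero] at h3
    exact (tendsto_zero_iff_abs_tendsto_zero _).2 h3
  -- This and `hA2` are conserved components of the rotating pair `(C, T)`, evaluated at infinity
  -- and at arrival.
  have hA1 : C 0 * Real.cos Δ - T 0 * Real.sin Δ = -1 := by
    have hc : ∀ s ≤ 0, C s * Real.cos (φ s) - T s * Real.sin (φ s)
        = C 0 * Real.cos (φ 0) - T 0 * Real.sin (φ 0) := fun s hs =>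
      eq_of_hasDerivWithinAt_zero (f := fun s => C s * Real.cos (φ s) - T s * Real.sin (φ s))
        (fun s hs => by
          have hφw := (dφ s).hasDerivWithinAt (s := Set.Iic 0)
          refine (((dC s hs).mul hφw.cos).sub ((dT s hs).mul hφw.sin)).congr_deriv ?_
          ring) hs
    have hlim := (lC.mul lcos).sub (lT.mul lsin)
    rw [hφ0] at hc
    refine tendsto_nhds_unique ((tendsto_const_nhds).congr' ?_) (hlim.trans (by norm_num))
    filter_upwards [eventually_le_atBot 0] with s hs using (hc s hs).symm
  have hA2 : C 0 * Real.sin Δ + T 0 * Real.cos Δ = 0 := by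
    have hc : ∀ s ≤ 0, C s * Real.sin (φ s) + T s * Real.cos (φ s)
        = C 0 * Real.sin (φ 0) + T 0 * Real.cos (φ 0) := fun s hs =>
      eq_of_hasDerivWithinAt_zero (f := fun s => C s * Real.sin (φ s) + T s * Real.cos (φ s))
        (fun s hs => by
          have hφw := (dφ s).hasDerivWithinAt (s := Set.Iic 0)
          refine (((dC s hs).mul hφw.sin).add ((dT s hs).mul hφw.cos)).congr_deriv ?_
          ring) hs
    have hlim := (lC.mul lsin).add (lT.mul lcos)
    rw [hφ0] at hc
    refine tendsto_nhds_unique ((tendsto_const_nhds).congr' ?_) (hlim.trans (by norm_num))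
    filter_upwards [eventually_le_atBot 0] with s hs using (hc s hs).symm
  have hcos : Real.cos Δ = -C 0 := by
    have := Real.sin_sq_add_cos_sq Δ
    linear_combination Real.cos Δ * hA1 + Real.sin Δ * hA2 - C 0 * this
  obtain ⟨σ, hσΔ, hσ, hσc, hσb⟩ := exists_inverse_parameter dφ hg hφ0 lφ
  have hσ' : ∀ y ∈ Set.Ioo 0 Δ, σ y < 0 ∧ ContinuousAt σ y := fun y hy =>
    ⟨(hσ y hy).1, (hσ y hy).2.continuousAt⟩
  have hd : ∀ {f f' : ℝ → ℝ} {l : ℝ}, (∀ s ≤ 0, HasDerivWithinAt f (g s * f' s) (Set.Iic 0) s) →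
      ∀ y ∈ Set.Ioo 0 Δ, HasDerivAt (Function.update (f ∘ σ) 0 l) (f' (σ y)) y := by
    intro f f' l hf y hy
    have hne : g (σ y) ≠ 0 := (hg _).ne'
    have h1 := ((hf (σ y) (hσ y hy).1.le).hasDerivAt (Iic_mem_nhds (hσ y hy).1)).comp y (hσ y hy).2
    refine (h1.congr_of_eventuallyEq ?_).congr_deriv (by field_simp)
    filter_upwards [lt_mem_nhds hy.1] with z hz
    exact Function.update_of_ne hz.ne' _ _
  have hwy : ∀ {f : ℝ → ℝ} {l y : ℝ}, 0 < y → Function.update (f ∘ σ) 0 l y = f (σ y) :=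
    fun hy => Function.update_of_ne hy.ne' _ _
  refine ⟨Δ, Function.update (w ∘ σ) 0 0, Function.update (ω ∘ σ) 0 μ, hΔ0, hΔπ, hcos, ?_, ?_⟩
  · refine ⟨?_, ?_, by simp, by simp, fun y hy => ?_, fun y hy => ?_, fun y hy => ?_⟩
    · exact continuousOn_update_comp hΔ0 (fun s hs => (dw s hs).continuousWithinAt) lw hσΔ hσ' hσc
        hσb
    · exact continuousOn_update_comp hΔ0 (fun s hs => (dω s hs).continuousWithinAt) lω hσΔ hσ' hσc
        hσb
    · rw [hwy hy.1]
      exact hd dw y hy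
    · rw [hwy hy.1]
      exact hd (f' := fun s => -w s + μ ^ 2 * G (w s)) dω y hy
    · rcases hy.1.eq_or_lt with rfl | hpos
      · simp [hη]
      · rw [hwy hpos]
        have hσ0 : σ y ≤ 0 := by
          rcases hy.2.eq_or_lt with rfl | hlt
          · exact hσΔ.le
          · exact (hσ y ⟨hpos, hlt⟩).1.le
        exact ⟨(hw _ hσ0).1.le, (hw _ hσ0).2⟩
  · rw [hwy hΔ0, hσΔ]

/-! ### Light rays as rays of geometrical optics -/

/-- Only the sign is at stake. Far out `ω` does not vanish, so its sign is constant there; if it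
were negative, the positive function `w` would decrease from its limit `0`. -/
theorem tendsto_of_sq_tendsto {g w ω : ℝ → ℝ} {μ : ℝ} (hμ : 0 < μ) (hg : ∀ s ≤ 0, 0 < g s)
    (dw : ∀ s ≤ 0, HasDerivWithinAt w (g s * ω s) (Set.Iic 0) s)
    (hω : ContinuousOn ω (Set.Iic 0)) (hw : ∀ s ≤ 0, 0 < w s) (lw : Tendsto w atBot (𝓝 0))
    (lsq : Tendsto (fun s => ω s ^ 2) atBot (𝓝 (μ ^ 2))) : Tendsto ω atBot (𝓝 μ) := by
  have labs : Tendsto (fun s => |ω s|) atBot (𝓝 μ) := by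
    have := lsq.sqrt
    simpa only [Real.sqrt_sq_eq_abs, abs_of_pos hμ] using this
  obtain ⟨s₀, hs₀⟩ := eventually_atBot.1
    ((labs.eventually (lt_mem_nhds hμ)).and (eventually_le_atBot 0))
  have hs₀0 : s₀ ≤ 0 := (hs₀ s₀ le_rfl).2
  have hsub : Set.Iic s₀ ⊆ Set.Iic 0 := Set.Iic_subset_Iic.2 hs₀0
  have hpos : ∀ s ≤ s₀, 0 < ω s := by
    intro s hs
    by_contra! hneg
    have hall : ∀ t ≤ s₀, ω t ≤ 0 := by
      intro t ht
      by_contra! htpos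
      obtain ⟨u, hu, hu0⟩ := isPreconnected_Iic.intermediate_value (Set.mem_Iic.2 hs)
        (Set.mem_Iic.2 ht) (hω.mono hsub) (show (0 : ℝ) ∈ Set.Icc (ω s) (ω t) from ⟨hneg, htpos.le⟩)
      have := (hs₀ u hu).1
      simp [hu0] at this
    have hanti : AntitoneOn w (Set.Iic s₀) := by
      refine antitoneOn_of_hasDerivWithinAt_nonpos (f' := fun s => g s * ω s) (convex_Iic s₀)
        (fun s hs => (dw s (hsub hs)).continuousWithinAt.mono hsub) ?_ ?_
      · intro t ht
        have ht' : t ∈ Set.Iic s₀ := interior_subset ht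
        exact (dw t (hsub ht')).mono (interior_subset.trans hsub)
      · intro t ht
        have ht' : t ∈ Set.Iic s₀ := interior_subset ht
        exact mul_nonpos_of_nonneg_of_nonpos (hg t (hsub ht')).le (hall t ht')
    have : w s₀ ≤ 0 := ge_of_tendsto lw <| by
      filter_upwards [eventually_le_atBot s₀] with t ht
      exact hanti ht (Set.mem_Iic.2 le_rfl) ht
    exact this.not_gt (hw s₀ hs₀0)
  refine labs.congr' ?_
  filter_upwards [eventually_le_atBot s₀] with s hs
  exact abs_of_pos (hpos s hs)

/-- A ray with parameter in `(-∞, 0]`, emitted at infinity in the direction `Ne`, in an isotropic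
medium whose squared refractive index is the function `U` of `m / r`, with `U' = 2 F`. -/
structure IsOpticalRay (F U : ℝ → ℝ) (m rh : ℝ) (Ne : E3) (x p : ℝ → E3) (k : ℝ → ℝ) : Prop where
  k_pos : ∀ s ≤ 0, 0 < k s
  k_cont : ContinuousOn k (Set.Iic 0)
  deriv_x : ∀ s ≤ 0, HasDerivWithinAt x (k s • p s) (Set.Iic 0) s
  deriv_p : ∀ s ≤ 0,
    HasDerivWithinAt p (-(k s * F (m / ‖x s‖) * m / ‖x s‖ ^ 3) • x s) (Set.Iic 0) s
  norm_p : ∀ s ≤ 0, ‖p s‖ ^ 2 = U (m / ‖x s‖)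
  region : ∀ s ≤ 0, rh < ‖x s‖
  fromInfinity : Tendsto (fun s => ‖x s‖) atBot atTop
  direction : Tendsto (fun s => unitDir (p s)) atBot (𝓝 Ne)

theorem hasDerivWithinAt_norm_of_ne_zero {x : ℝ → E3} {x' : E3} {S : Set ℝ} {s : ℝ}
    (h : HasDerivWithinAt x x' S s) (h0 : x s ≠ 0) :
    HasDerivWithinAt (fun s => ‖x s‖) (inner ℝ (x s) x' / ‖x s‖) S s := by
  have h1 := h.norm_sq.sqrt (by simpa using h0)
  simp only [Real.sqrt_sq (norm_nonneg _)] at h1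
  exact h1.congr_deriv (by field_simp)

section
variable {F U : ℝ → ℝ} {m rh : ℝ} {Ne : E3} {x p : ℝ → E3} {k : ℝ → ℝ}

theorem IsOpticalRay.norm_pos (h : IsOpticalRay F U m rh Ne x p k) (hrh : 0 < rh) {s : ℝ}
    (hs : s ≤ 0) : 0 < ‖x s‖ := hrh.trans (h.region s hs)

theorem IsOpticalRay.hasDerivWithinAt_norm (h : IsOpticalRay F U m rh Ne x p k) (hrh : 0 < rh)
    {s : ℝ} (hs : s ≤ 0) :
    HasDerivWithinAt (fun s => ‖x s‖) (k s * inner ℝ (x s) (p s) / ‖x s‖) (Set.Iic 0) s := by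
  have h0 := h.norm_pos hrh hs
  refine (hasDerivWithinAt_norm_of_ne_zero (h.deriv_x s hs) (norm_pos_iff.1 h0)).congr_deriv ?_
  rw [real_inner_smul_right]

theorem IsOpticalRay.hasDerivWithinAt_inner (h : IsOpticalRay F U m rh Ne x p k) (hrh : 0 < rh)
    {s : ℝ} (hs : s ≤ 0) :
    HasDerivWithinAt (fun s => inner ℝ (x s) (p s))
      (k s * ‖p s‖ ^ 2 - k s * F (m / ‖x s‖) * m / ‖x s‖) (Set.Iic 0) s := by
  have h0 := h.norm_pos hrh hs
  refine ((h.deriv_x s hs).inner ℝ (h.deriv_p s hs)).congr_deriv ?_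
  rw [real_inner_smul_right, real_inner_smul_left, real_inner_self_eq_norm_sq,
    real_inner_self_eq_norm_sq]
  field_simp
  ring

theorem IsOpticalRay.angularMomentum_const (h : IsOpticalRay F U m rh Ne x p k) (hrh : 0 < rh)
    {s : ℝ} (hs : s ≤ 0) :
    ‖x s‖ ^ 2 * ‖p s‖ ^ 2 - inner ℝ (x s) (p s) ^ 2
      = ‖x 0‖ ^ 2 * ‖p 0‖ ^ 2 - inner ℝ (x 0) (p 0) ^ 2 := by
  refine eq_of_hasDerivWithinAt_zero
    (f := fun s => ‖x s‖ ^ 2 * ‖p s‖ ^ 2 - inner ℝ (x s) (p s) ^ 2) (fun s hs => ?_) hs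
  have h0 := h.norm_pos hrh hs
  refine ((((h.deriv_x s hs).norm_sq).mul ((h.deriv_p s hs).norm_sq)).sub
    ((h.hasDerivWithinAt_inner hrh hs).pow 2)).congr_deriv ?_
  rw [real_inner_smul_right, real_inner_smul_right, real_inner_comm (x s) (p s)]
  push_cast
  field_simp
  ring

/-- `C` and `T` are the components of the unit vector `Ne` along the radial and the transverse unit
vectors of the plane of `x` and `p`, so this is Bessel's inequality. -/
theorem bessel_of_gram {Ne x p : E3} {b C T : ℝ} (hNe : ‖Ne‖ = 1) (hx : 0 < ‖x‖) (hb : 0 < b)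
    (hbx : ‖x‖ ^ 2 * ‖p‖ ^ 2 - inner ℝ x p ^ 2 = b ^ 2) (hC : C = inner ℝ x Ne / ‖x‖)
    (hT : T = (‖x‖ * inner ℝ p Ne - inner ℝ x p * (inner ℝ x Ne / ‖x‖)) / b) :
    C ^ 2 + T ^ 2 ≤ 1 := by
  -- The subtracted vector is the orthogonal projection of `Ne` onto the span of `x` and `p`.
  have h := sq_nonneg ‖Ne - ((C / ‖x‖ - T * inner ℝ x p / (‖x‖ * b)) • x + (T * ‖x‖ / b) • p)‖
  rw [norm_sub_sq_real, norm_add_sq_real, inner_add_right, norm_smul, norm_smul, mul_pow, mul_pow,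
    Real.norm_eq_abs, Real.norm_eq_abs, sq_abs, sq_abs, real_inner_smul_left,
    real_inner_smul_right, real_inner_smul_right, real_inner_smul_right, hNe,
    real_inner_comm x Ne, real_inner_comm p Ne] at h
  have hX : inner ℝ x Ne = C * ‖x‖ := by rw [hC]; field_simp
  have hQ : inner ℝ p Ne = (T * b + inner ℝ x p * C) / ‖x‖ := by
    rw [hT, hX]
    field_simp
    ring
  have hN : ‖p‖ ^ 2 = (b ^ 2 + inner ℝ x p ^ 2) / ‖x‖ ^ 2 := by
    rw [← hbx]
    field_simp
    ring
  rw [hX, hQ, hN] at h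
  have : (0 : ℝ) ≤ 1 - C ^ 2 - T ^ 2 := by
    refine h.trans (le_of_eq ?_)
    field_simp
    ring
  linarith

/-- Binet's substitution, done with scalar products instead of polar coordinates: the angular
velocity is `k b / r²`, and `|x × p|² = b²` eliminates `‖p‖`. -/
theorem IsOpticalRay.exists_orbit (h : IsOpticalRay F U m rh Ne x p k) (hm : 0 < m)
    (hrh : 0 < rh) (hNe : ‖Ne‖ = 1) {K b : ℝ} (hF : ∀ y ∈ Set.Icc 0 (m / rh), |F y| ≤ K)
    (hU : ContinuousAt U 0) (hU0 : U 0 = 1) (hb : 0 < b)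
    (hbx : ‖x 0‖ ^ 2 * ‖p 0‖ ^ 2 - inner ℝ (x 0) (p 0) ^ 2 = b ^ 2)
    (hsmall : (m / b) ^ 2 * K * Real.pi < m / ‖x 0‖) :
    ∃ ψ w ω, 0 < ψ ∧ ψ ≤ Real.pi ∧ Real.cos ψ = -inner ℝ Ne (unitDir (x 0)) ∧
      IsOrbit F (m / b) ψ (m / rh) w ω ∧ w ψ = m / ‖x 0‖ := by
  have hμ : 0 < m / b := by positivity
  have hr : ∀ s ≤ 0, 0 < ‖x s‖ := fun s hs => h.norm_pos hrh hs
  have hbs : ∀ s ≤ 0, ‖x s‖ ^ 2 * ‖p s‖ ^ 2 - inner ℝ (x s) (p s) ^ 2 = b ^ 2 := fun s hs =>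
    (h.angularMomentum_const hrh hs).trans hbx
  have hxc : ContinuousOn (fun s => ‖x s‖) (Set.Iic 0) := fun s hs =>
    (h.hasDerivWithinAt_norm hrh hs).continuousWithinAt
  set g₀ : ℝ → ℝ := fun s => k s * b / ‖x s‖ ^ 2 with hg₀
  -- Freezing the angular velocity after arrival makes it continuous and positive on the whole line,
  -- as `exists_orbit_of_sweep` requires.
  set g : ℝ → ℝ := fun s => g₀ (min s 0) with hgd
  have hgs : ∀ s ≤ 0, g s = k s * b / ‖x s‖ ^ 2 := fun s hs => by
    simp only [hgd, hg₀, min_eq_left hs]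
  have hgpos : ∀ s, 0 < g s := fun s => by
    have h1 := h.k_pos (min s 0) (min_le_right _ _)
    have h2 := hr (min s 0) (min_le_right _ _)
    simp only [hgd, hg₀]
    positivity
  have hgc : Continuous g := by
    have hg₀c : ContinuousOn g₀ (Set.Iic 0) :=
      (h.k_cont.mul continuousOn_const).div (hxc.pow 2) fun s hs => (pow_pos (hr s hs) 2).ne'
    exact hg₀c.comp_continuous (by fun_prop) fun s => min_le_right s 0
  set w : ℝ → ℝ := fun s => m / ‖x s‖ with hw
  set ω : ℝ → ℝ := fun s => -(m / b) * (inner ℝ (x s) (p s) / ‖x s‖) with hω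
  set C : ℝ → ℝ := fun s => inner ℝ (x s) Ne / ‖x s‖ with hC
  set T : ℝ → ℝ := fun s =>
    (‖x s‖ * inner ℝ (p s) Ne - inner ℝ (x s) (p s) * (inner ℝ (x s) Ne / ‖x s‖)) / b with hT
  have dX : ∀ s ≤ 0, HasDerivWithinAt (fun s => inner ℝ (x s) Ne) (k s * inner ℝ (p s) Ne)
      (Set.Iic 0) s := fun s hs =>
    ((h.deriv_x s hs).inner ℝ (hasDerivWithinAt_const _ _ Ne)).congr_deriv
      (by rw [real_inner_smul_left, inner_zero_right, zero_add])
  have dQ : ∀ s ≤ 0, HasDerivWithinAt (fun s => inner ℝ (p s) Ne)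
      (-(k s * F (m / ‖x s‖) * m / ‖x s‖ ^ 3) * inner ℝ (x s) Ne) (Set.Iic 0) s := fun s hs =>
    ((h.deriv_p s hs).inner ℝ (hasDerivWithinAt_const _ _ Ne)).congr_deriv
      (by rw [real_inner_smul_left, inner_zero_right, zero_add])
  have dC : ∀ s ≤ 0, HasDerivWithinAt C (g s * T s) (Set.Iic 0) s := fun s hs => by
    have h0 := hr s hs
    refine ((dX s hs).div (h.hasDerivWithinAt_norm hrh hs) h0.ne').congr_deriv ?_
    rw [hgs s hs, hT]
    field_simp
  have dT : ∀ s ≤ 0, HasDerivWithinAt T (-(g s * C s)) (Set.Iic 0) s := fun s hs => by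
    have h0 := hr s hs
    refine ((((h.hasDerivWithinAt_norm hrh hs).mul (dQ s hs)).sub
      ((h.hasDerivWithinAt_inner hrh hs).mul (dC s hs))).div_const b).congr_deriv ?_
    have hb2 := hbs s hs
    have hN : ‖p s‖ ^ 2 = (b ^ 2 + inner ℝ (x s) (p s) ^ 2) / ‖x s‖ ^ 2 := by
      rw [← hb2]
      field_simp
      ring
    rw [hgs s hs, hN]
    simp only [hT, hC]
    field_simp
    ring
  have dw : ∀ s ≤ 0, HasDerivWithinAt w (g s * ω s) (Set.Iic 0) s := fun s hs => by
    have h0 := hr s hs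
    refine ((hasDerivWithinAt_const _ _ m).div (h.hasDerivWithinAt_norm hrh hs)
      h0.ne').congr_deriv ?_
    rw [hgs s hs, hω]
    field_simp
    ring
  have dω : ∀ s ≤ 0, HasDerivWithinAt ω (g s * (-w s + (m / b) ^ 2 * F (w s))) (Set.Iic 0) s :=
    fun s hs => by
    have h0 := hr s hs
    refine (((h.hasDerivWithinAt_inner hrh hs).div (h.hasDerivWithinAt_norm hrh hs)
      h0.ne').const_mul (-(m / b))).congr_deriv ?_
    have hb2 := hbs s hs
    have hN : ‖p s‖ ^ 2 = (b ^ 2 + inner ℝ (x s) (p s) ^ 2) / ‖x s‖ ^ 2 := by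
      rw [← hb2]
      field_simp
      ring
    rw [hgs s hs, hN]
    simp only [hw]
    field_simp
    ring
  have hwpos : ∀ s ≤ 0, 0 < w s ∧ w s ≤ m / rh := fun s hs =>
    ⟨div_pos hm (hr s hs), div_le_div_of_nonneg_left hm.le hrh (h.region s hs).le⟩
  have lw : Tendsto w atBot (𝓝 0) := h.fromInfinity.const_div_atTop m
  have lU : Tendsto (fun s => U (w s)) atBot (𝓝 1) := by
    have := hU.tendsto.comp lw
    rwa [hU0] at this
  have lsq : Tendsto (fun s => ω s ^ 2) atBot (𝓝 ((m / b) ^ 2)) := by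
    have h1 := (lU.const_mul ((m / b) ^ 2)).sub (lw.pow 2)
    simp only [mul_one, ne_eq, OfNat.ofNat_ne_zero, not_false_eq_true, zero_pow, sub_zero] at h1
    refine h1.congr' ?_
    filter_upwards [eventually_le_atBot 0] with s hs
    have h0 := hr s hs
    have hS : inner ℝ (x s) (p s) ^ 2 = ‖x s‖ ^ 2 * ‖p s‖ ^ 2 - b ^ 2 := by
      rw [← hbs s hs]; ring
    rw [← h.norm_p s hs]
    simp only [hω, hw]
    rw [mul_pow, div_pow (inner ℝ (x s) (p s)), hS]
    field_simp
  have lω : Tendsto ω atBot (𝓝 (m / b)) :=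
    tendsto_of_sq_tendsto hμ (fun s _ => hgpos s) dw
      (fun s hs => (dω s hs).continuousWithinAt) (fun s hs => (hwpos s hs).1) lw lsq
  have hCT : ∀ s ≤ 0, C s ^ 2 + T s ^ 2 ≤ 1 := fun s hs =>
    bessel_of_gram hNe (hr s hs) hb (hbs s hs) rfl rfl
  have lQ : Tendsto (fun s => inner ℝ (p s) Ne) atBot (𝓝 1) := by
    have h1 : Tendsto (fun s => ‖p s‖) atBot (𝓝 1) := by
      have := lU.sqrt
      rw [Real.sqrt_one] at this
      refine this.congr' ?_
      filter_upwards [eventually_le_atBot 0] with s hs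
      rw [hw, ← h.norm_p s hs, Real.sqrt_sq (norm_nonneg _)]
    have h2 : Tendsto (fun s => inner ℝ (unitDir (p s)) Ne) atBot (𝓝 1) := by
      have := Filter.Tendsto.inner (𝕜 := ℝ) h.direction (tendsto_const_nhds (x := Ne))
      rwa [real_inner_self_eq_norm_sq, hNe, one_pow] at this
    have h3 := h1.mul h2
    rw [one_mul] at h3
    refine h3.congr' ?_
    filter_upwards [h1.eventually (lt_mem_nhds one_pos)] with s hs
    rw [unitDir, real_inner_smul_left]
    field_simp
  have lTr : Tendsto (fun s => T s * (b / ‖x s‖)) atBot (𝓝 0) := by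
    have h1 : Tendsto (fun s => b / ‖x s‖) atBot (𝓝 0) := h.fromInfinity.const_div_atTop b
    refine squeeze_zero_norm' ?_ h1
    filter_upwards [eventually_le_atBot 0] with s hs
    have h0 := hr s hs
    have hT1 : |T s| ≤ 1 := abs_le_one_iff_mul_self_le_one.2 (by nlinarith [hCT s hs, sq_nonneg (C s)])
    rw [norm_mul, Real.norm_eq_abs, Real.norm_eq_abs, abs_of_pos (div_pos hb h0)]
    exact mul_le_of_le_one_left (div_pos hb h0).le hT1
  -- The definition of `T` gives `C = (⟨p, Ne⟩ - T b / r) / (⟨x, p⟩ / r)`: the numerator tends to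
  -- `1`, and the denominator to `-1` since the ray is incoming.
  have lC : Tendsto C atBot (𝓝 (-1)) := by
    have h1 := (lQ.sub lTr).div (lω.div_const (-(m / b))) (by
      rw [div_neg, div_self hμ.ne']; norm_num)
    rw [sub_zero, div_neg, div_self hμ.ne', div_neg, div_one] at h1
    refine h1.congr' ?_
    filter_upwards [eventually_le_atBot 0, lω.eventually (lt_mem_nhds hμ)] with s hs hs'
    have h0 := hr s hs
    have hS : inner ℝ (x s) (p s) ≠ 0 := by
      intro hS
      simp [hω, hS] at hs'
    simp only [Pi.div_apply, hω, hT, hC]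
    field_simp
    ring
  obtain ⟨ψ, w', ω', h1, h2, h3, h4, h5⟩ := exists_orbit_of_sweep hgc hgpos dw dω dC dT hwpos
    (by positivity) (fun s hs => hF _ ⟨(hwpos s hs).1.le, (hwpos s hs).2⟩) lw lω lC hCT hsmall
  refine ⟨ψ, w', ω', h1, h2, ?_, h4, h5⟩
  rw [h3, hC, unitDir, real_inner_smul_right, real_inner_comm]
  field_simp

end

/-! ### Null geodesics as rays of geometrical optics -/

/-- `spatial` as a continuous linear map. -/
noncomputable def spatialCLM : Event →L[ℝ] E3 :=
  LinearMap.toContinuousLinearMap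
    { toFun := spatial
      map_add' := fun X Y => by ext i; simp [spatial]
      map_smul' := fun c X => by ext i; simp [spatial] }

theorem spatialCLM_apply (X : Event) : spatialCLM X = spatial X := rfl

theorem spatial_event (t : ℝ) (x : E3) : spatial (event t x) = x := by
  ext i; simp [spatial, event]

theorem inner_spatial_single_zero (x : E3) :
    inner ℝ x (spatial (Pi.single (0 : Fin 4) 1)) = 0 := by
  have : spatial (Pi.single (0 : Fin 4) 1) = 0 := by
    ext i; simp [spatial]
  rw [this, inner_zero_right]

theorem inner_spatial_single_succ (x : E3) (i : Fin 3) :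
    inner ℝ x (spatial (Pi.single i.succ 1)) = x i := by
  have : spatial (Pi.single i.succ 1) = EuclideanSpace.single i (1 : ℝ) := by
    ext j
    simp [spatial, Pi.single_apply]
  rw [this, real_inner_comm, EuclideanSpace.inner_single_left]
  simp

theorem norm_spatial_sq (V : Event) : ‖spatial V‖ ^ 2 = ∑ i : Fin 3, V i.succ ^ 2 := by
  rw [EuclideanSpace.real_norm_sq_eq]
  rfl

theorem covector_metric_zero (P : PPN) (m : ℝ) (X V : Event) :
    covector (P.metric m) X V 0 = P.potA m ‖spatial X‖ * V 0 := by
  simp [covector, PPN.metric, Matrix.mulVec_diagonal]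

theorem covector_metric_succ (P : PPN) (m : ℝ) (X V : Event) (i : Fin 3) :
    covector (P.metric m) X V i.succ = -P.potBinv m ‖spatial X‖ * V i.succ := by
  simp [covector, PPN.metric, Matrix.mulVec_diagonal]

theorem spatial_covector_metric (P : PPN) (m : ℝ) (X V : Event) :
    spatial (covector (P.metric m) X V) = -P.potBinv m ‖spatial X‖ • spatial V := by
  ext i
  simpa [spatial] using covector_metric_succ P m X V i

/-- The factor `c` is a component of the gradient of `m / r` in the geodesic equation and `1` in the
null condition. -/
theorem sum_diagonal_quadratic (a b c : ℝ) (V : Event) :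
    ∑ β, ∑ δ, (if β = δ then Fin.cons (α := fun _ => ℝ) a (fun _ : Fin 3 => b) β * c else 0)
        * V β * V δ = c * (a * V 0 ^ 2 + b * ‖spatial V‖ ^ 2) := by
  simp only [ite_mul, zero_mul, Finset.sum_ite_eq, Finset.mem_univ, if_true]
  rw [Fin.sum_univ_succ, norm_spatial_sq, mul_add, mul_comm a, mul_comm b, Finset.sum_mul,
    Finset.mul_sum]
  simp only [Fin.cons_zero, Fin.cons_succ]
  congr 1
  · ring
  · exact Finset.sum_congr rfl fun i _ => by ring

theorem fderiv_comp_div_norm_spatial {f : ℝ → ℝ} {m : ℝ} {X : Event} (hX : spatial X ≠ 0)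
    (hf : DifferentiableAt ℝ f (m / ‖spatial X‖)) (W : Event) :
    fderiv ℝ (fun Y : Event => f (m / ‖spatial Y‖)) X W
      = deriv f (m / ‖spatial X‖) *
        (-(m / ‖spatial X‖ ^ 3) * inner ℝ (spatial X) (spatial W)) := by
  have hn : ‖spatial X‖ ≠ 0 := norm_ne_zero_iff.2 hX
  have h1 : HasFDerivAt (fun Y : Event => ‖spatial Y‖ ^ 2) _ X :=
    (spatialCLM.hasFDerivAt (x := X)).norm_sq
  have h2 := h1.sqrt (pow_ne_zero 2 hn)
  simp only [Real.sqrt_sq (norm_nonneg _)] at h2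
  have h3 := (hasDerivAt_inv hn).comp_hasFDerivAt X h2
  have h4 := h3.const_mul m
  have h5 := HasDerivAt.comp_hasFDerivAt X (h₂ := f) (f := fun Y : Event => m * ‖spatial Y‖⁻¹)
    (by rw [← div_eq_mul_inv]; exact hf.hasDerivAt) h4
  have h6 : HasFDerivAt (fun Y : Event => f (m / ‖spatial Y‖)) _ X := h5
  rw [h6.fderiv]
  simp [spatialCLM_apply]
  left
  field_simp

theorem metricDeriv_metric {P : PPN} {m : ℝ} {X : Event} (hX : spatial X ≠ 0)
    (hA : DifferentiableAt ℝ P.seriesA (m / ‖spatial X‖))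
    (hB : DifferentiableAt ℝ P.seriesB (m / ‖spatial X‖)) (α β δ : Fin 4) :
    metricDeriv (P.metric m) X α β δ = if β = δ then
      Fin.cons (α := fun _ => ℝ) (deriv P.seriesA (m / ‖spatial X‖))
        (fun _ : Fin 3 => -deriv P.seriesB (m / ‖spatial X‖)) β *
        (-(m / ‖spatial X‖ ^ 3) * inner ℝ (spatial X) (spatial (Pi.single α 1))) else 0 := by
  unfold metricDeriv
  split_ifs with h
  · subst h
    refine Fin.cases ?_ (fun i => ?_) β
    · have : (fun Y : Event => P.metric m Y 0 0) = fun Y => P.seriesA (m / ‖spatial Y‖) := by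
        funext Y
        simp [PPN.metric, PPN.potA, PPN.seriesA]
      rw [this, fderiv_comp_div_norm_spatial hX hA, Fin.cons_zero]
    · have : (fun Y : Event => P.metric m Y i.succ i.succ)
          = fun Y => (-P.seriesB) (m / ‖spatial Y‖) := by
        funext Y
        simp [PPN.metric, PPN.potBinv, PPN.seriesB]
      rw [this, fderiv_comp_div_norm_spatial hX hB.neg, Fin.cons_succ, deriv.neg']
  · have : (fun Y : Event => P.metric m Y β δ) = fun _ => 0 := by
      funext Y
      simp [PPN.metric, h]
    rw [this]
    simp

theorem norm_cross_sq (a b : E3) :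
    ‖cross a b‖ ^ 2 = ‖a‖ ^ 2 * ‖b‖ ^ 2 - inner ℝ a b ^ 2 := by
  simp only [EuclideanSpace.real_norm_sq_eq, PiLp.inner_apply, Fin.sum_univ_three, cross,
    cross_apply]
  simp
  ring

theorem cross_smul_right (c : ℝ) (a b : E3) : cross a (c • b) = c • cross a b := by
  simp [cross]

theorem unitDir_smul {c : ℝ} (hc : 0 < c) (x : E3) : unitDir (c • x) = unitDir x := by
  rw [unitDir, unitDir, norm_smul, Real.norm_of_nonneg hc.le, smul_smul]
  congr 1
  field_simp

/-- The optical momentum is `p = -l / E` in its spatial part, and `k = E / 𝓑⁻¹`. The null condition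
fixes `‖p‖² = 𝓑⁻¹ / 𝓐`, and since `E` is constant the spatial geodesic equation becomes Hamilton's
equation for `p`. Then `|x × p|` is `J / E`. -/
theorem IsRayFromInfinity.exists_opticalRay {P : PPN} {m rh : ℝ} {Ne xB : E3} {x0B : ℝ}
    {X V : ℝ → Event} (h : IsRayFromInfinity P m rh Ne xB x0B X V) (hm : 0 < m) (hrh : 0 < rh)
    {δ : ℝ} (hδ : m / rh < δ) (hP : ∀ y, |y| < δ → AnalyticAt ℝ P.seriesA y ∧
      AnalyticAt ℝ P.seriesB y ∧ 0 < P.seriesA y ∧ 0 < P.seriesB y) :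
    ∃ p k, IsOpticalRay P.force P.index m rh Ne (fun s => spatial (X s)) p k ∧
      ∀ s ≤ 0, impactParameter (P.metric m) (X s) (V s) = ‖cross (spatial (X s)) (p s)‖ := by
  have hr : ∀ s ≤ 0, 0 < ‖spatial (X s)‖ := fun s hs => hrh.trans (h.region s hs)
  have hy : ∀ s ≤ 0, |m / ‖spatial (X s)‖| < δ := fun s hs => by
    rw [abs_of_pos (div_pos hm (hr s hs))]
    exact (div_le_div_of_nonneg_left hm.le hrh (h.region s hs).le).trans_lt hδ
  set A : ℝ → ℝ := fun s => P.seriesA (m / ‖spatial (X s)‖) with hA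
  set B : ℝ → ℝ := fun s => P.seriesB (m / ‖spatial (X s)‖) with hB
  have hApos : ∀ s ≤ 0, 0 < A s := fun s hs => (hP _ (hy s hs)).2.2.1
  have hBpos : ∀ s ≤ 0, 0 < B s := fun s hs => (hP _ (hy s hs)).2.2.2
  set l : ℝ → Event := fun s => covector (P.metric m) (X s) (V s) with hl
  have hl0 : ∀ s, l s 0 = A s * V s 0 := fun s => covector_metric_zero P m (X s) (V s)
  have hls : ∀ s, spatial (l s) = -B s • spatial (V s) := fun s =>
    spatial_covector_metric P m (X s) (V s)
  set E : ℝ := l 0 0 with hE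
  have hEpos : 0 < E := by
    rw [hE, hl0]
    exact mul_pos (hApos 0 le_rfl) (h.future 0 le_rfl)
  have dl : ∀ s ≤ 0, HasDerivWithinAt l (fun α =>
      1 / 2 * (-(m / ‖spatial (X s)‖ ^ 3) * inner ℝ (spatial (X s)) (spatial (Pi.single α 1)) *
        (deriv P.seriesA (m / ‖spatial (X s)‖) * V s 0 ^ 2
          + -deriv P.seriesB (m / ‖spatial (X s)‖) * ‖spatial (V s)‖ ^ 2))) (Set.Iic 0) s := by
    intro s hs
    refine (h.nullGeodesic.geodesic s hs).congr_deriv ?_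
    funext α
    obtain ⟨h1, h2, -, -⟩ := hP _ (hy s hs)
    simp only [metricDeriv_metric (norm_pos_iff.1 (hr s hs)) h1.differentiableAt
      h2.differentiableAt]
    rw [sum_diagonal_quadratic]
  have hEs : ∀ s ≤ 0, A s * V s 0 = E := fun s hs => by
    rw [← hl0, hE]
    refine eq_of_hasDerivWithinAt_zero (f := fun s => l s 0) (fun s hs => ?_) hs
    refine (hasDerivWithinAt_pi.1 (dl s hs) 0).congr_deriv ?_
    rw [inner_spatial_single_zero]
    ring
  have hnull : ∀ s ≤ 0, A s * V s 0 ^ 2 = B s * ‖spatial (V s)‖ ^ 2 := fun s hs => by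
    have h1 := h.nullGeodesic.null s hs
    have h2 : ∀ β δ, P.metric m (X s) β δ = if β = δ then
        Fin.cons (α := fun _ => ℝ) (A s) (fun _ : Fin 3 => -B s) β * 1 else 0 := fun β δ => by
      rw [mul_one]
      rfl
    simp only [h2] at h1
    rw [sum_diagonal_quadratic] at h1
    linarith
  have hv : ∀ s ≤ 0, ‖spatial (V s)‖ ^ 2 = E ^ 2 / (A s * B s) := fun s hs => by
    have h1 := hApos s hs
    have h2 := hBpos s hs
    have h3 := hnull s hs
    rw [← hEs s hs]
    field_simp
    linarith
  have dX : ∀ s ≤ 0, HasDerivWithinAt (fun s => spatial (X s)) (spatial (V s)) (Set.Iic 0) s :=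
    fun s hs => (spatialCLM.hasFDerivAt (x := X s)).comp_hasDerivWithinAt s
      (h.nullGeodesic.tangent s hs)
  have hp : ∀ s, -E⁻¹ • spatial (l s) = (B s / E) • spatial (V s) := fun s => by
    rw [hls, smul_smul]
    congr 1
    ring
  refine ⟨fun s => -E⁻¹ • spatial (l s), fun s => E / B s, ?_, fun s hs => ?_⟩
  · refine ⟨fun s hs => div_pos hEpos (hBpos s hs), ?_, fun s hs => ?_, fun s hs => ?_,
      fun s hs => ?_, h.region, h.fromInfinity, ?_⟩
    · refine continuousOn_const.div (fun s hs => ?_) fun s hs => (hBpos s hs).ne'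
      have hn := hasDerivWithinAt_norm_of_ne_zero (dX s hs) (norm_pos_iff.1 (hr s hs))
      have hd : ContinuousWithinAt (fun s => m / ‖spatial (X s)‖) (Set.Iic 0) s :=
        continuousWithinAt_const.div hn.continuousWithinAt (hr s hs).ne'
      exact ContinuousAt.comp_continuousWithinAt (f := fun s => m / ‖spatial (X s)‖)
        (hP _ (hy s hs)).2.1.continuousAt hd
    · refine (dX s hs).congr_deriv ?_
      have := hBpos s hs
      rw [hp, smul_smul, show E / B s * (B s / E) = 1 by field_simp, one_smul]
    · have h1 := ((spatialCLM.hasFDerivAt (x := l s)).comp_hasDerivWithinAt s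
        (dl s hs)).const_smul (-E⁻¹)
      refine HasDerivWithinAt.congr_deriv (f := fun s => -E⁻¹ • spatial (l s)) h1 ?_
      ext i
      have h3 := hApos s hs
      have h4 := hBpos s hs
      have h5 := hr s hs
      have hV0 : V s 0 = E / A s := by
        rw [← hEs s hs]
        field_simp
      change -E⁻¹ * (1 / 2 * (-(m / ‖spatial (X s)‖ ^ 3) *
        inner ℝ (spatial (X s)) (spatial (Pi.single i.succ 1)) * _)) =
        -(E / B s * P.force (m / ‖spatial (X s)‖) * m / ‖spatial (X s)‖ ^ 3) * spatial (X s) i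
      rw [inner_spatial_single_succ, hv s hs, hV0, PPN.force]
      change _ = -(E / B s * ((_ * A s - B s * _) / (2 * A s ^ 2)) * m / ‖spatial (X s)‖ ^ 3) *
        spatial (X s) i
      field_simp
      ring
    · have h3 := hApos s hs
      have h4 := hBpos s hs
      rw [hp, norm_smul, mul_pow, hv s hs, Real.norm_eq_abs, sq_abs]
      change _ = B s / A s
      field_simp
    · refine h.direction.congr' ?_
      filter_upwards [eventually_le_atBot 0] with s hs
      rw [hp, unitDir_smul (div_pos (hBpos s hs) hEpos)]
  · have h1 : covector (P.metric m) (X s) (V s) 0 = E := by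
      rw [covector_metric_zero]
      exact hEs s hs
    rw [impactParameter, h1, cross_smul_right, norm_smul, norm_neg, norm_inv,
      Real.norm_of_nonneg hEpos.le, div_eq_inv_mul]

/-! ### The impact parameter as a function of the mass parameter -/

theorem analyticAt_sqrt {x : ℝ} (hx : 0 < x) : AnalyticAt ℝ Real.sqrt x := by
  have h : AnalyticAt ℝ (fun y : ℝ => Real.exp (Real.log y / 2)) x :=
    ((analyticAt_log hx).div analyticAt_const two_ne_zero).rexp
  refine h.congr ?_
  filter_upwards [lt_mem_nhds hx] with y hy
  rw [Real.exp_half, Real.exp_log hy]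

theorem rc_sq {Ne xB : E3} (hNe : ‖Ne‖ = 1) (hxB : 0 < ‖xB‖) :
    rc Ne xB ^ 2 = ‖xB‖ ^ 2 - inner ℝ xB Ne ^ 2 := by
  rw [rc, mul_pow, norm_cross_sq, unitDir, hNe, norm_smul, norm_inv, norm_norm,
    real_inner_smul_right, real_inner_comm]
  field_simp

theorem hasDerivAt_event (t c : ℝ) (u x : E3) (s : ℝ) :
    HasDerivAt (fun s : ℝ => event (t + s * c) ((s * c) • u + x)) (event c (c • u)) s := by
  refine hasDerivAt_pi.2 fun i => ?_
  refine Fin.cases ?_ (fun j => ?_) i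
  · simpa [event] using ((hasDerivAt_id s).mul_const c).const_add t
  · simpa [event] using (((hasDerivAt_id s).mul_const c).mul_const (u j)).add_const (x j)

/-- Only the expansion at `s = 0` enters, so it does not matter that the range of admissible `m` may
depend on `s`. The constant term is found by differentiating the unperturbed half-line from the
left. -/
theorem IsQuasiMinkowskianFromInfinity.exists_analytic_velocity {P : PPN} {rh : ℝ} {Ne xB : E3}
    {x0B : ℝ} {X V : ℝ → ℝ → Event} (h : IsQuasiMinkowskianFromInfinity P rh Ne xB x0B X V) :
    ∃ v : ℝ → Event, (∀ i, AnalyticAt ℝ (fun m => v m i) 0) ∧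
      v 0 = event (rc Ne xB) (rc Ne xB • Ne) ∧ ∀ᶠ m in 𝓝[>] (0 : ℝ), V m 0 = v m := by
  obtain ⟨Ξ, Ξ', h0, hd, hs⟩ := h.perturbation
  have hsum : ∀ᶠ m in 𝓝[>] (0 : ℝ), ∀ i, HasSum (fun n => Ξ' n 0 i * m ^ n) (V m 0 i) := by
    filter_upwards [hs 0 le_rfl] with m hm i
    simpa [mul_comm] using (Pi.hasSum.1 hm.2) i
  obtain ⟨m₁, hm₁, hm₁pos⟩ := (hsum.and self_mem_nhdsWithin).exists
  refine ⟨fun m i => ∑' n, Ξ' n 0 i * m ^ n, fun i =>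
    analyticAt_tsum (ne_of_gt hm₁pos) (hm₁ i).summable, ?_, ?_⟩
  · have hder : HasDerivWithinAt (Ξ 0) (event (rc Ne xB) (rc Ne xB • Ne)) (Set.Iic 0) 0 :=
      (hasDerivAt_event x0B (rc Ne xB) Ne xB 0).hasDerivWithinAt.congr h0 (h0 0 le_rfl)
    have heq : Ξ' 0 0 = event (rc Ne xB) (rc Ne xB • Ne) :=
      (uniqueDiffWithinAt_Iic 0).eq_deriv (Set.Iic 0) (hd 0 0 le_rfl) hder
    funext i
    rw [← heq]
    change ∑' n, Ξ' n 0 i * (0 : ℝ) ^ n = Ξ' 0 0 i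
    rw [tsum_eq_single 0]
    · simp
    · intro n hn
      simp [hn]
  · filter_upwards [hsum] with m hm
    funext i
    exact (hm i).tsum_eq.symm

/-- At arrival the position is fixed, so `b = 𝓑⁻¹ |x_B × v| / (𝓐 v⁰)` with `v` analytic in `m`. The
square root is harmless because `|x_B × v|²` equals `r_c⁴ > 0` at `m = 0`; this is where the ray
must not be radial. -/
theorem IsQuasiMinkowskianFromInfinity.exists_analytic_impact {P : PPN} {rh : ℝ} {Ne xB : E3}
    {x0B : ℝ} {X V : ℝ → ℝ → Event} (h : IsQuasiMinkowskianFromInfinity P rh Ne xB x0B X V)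
    (hNe : ‖Ne‖ = 1) (hxB : 0 < ‖xB‖) (hrc : 0 < rc Ne xB)
    (hA : AnalyticAt ℝ P.seriesA 0) (hB : AnalyticAt ℝ P.seriesB 0) :
    ∃ b : ℝ → ℝ, AnalyticAt ℝ b 0 ∧ b 0 = rc Ne xB ∧
      ∀ᶠ m in 𝓝[>] (0 : ℝ), impactParameter (P.metric m) (X m 0) (V m 0) = b m := by
  obtain ⟨v, hv, hv0, hV⟩ := h.exists_analytic_velocity
  set D : ℝ → ℝ := fun m => ‖xB‖ ^ 2 * (∑ i : Fin 3, v m i.succ ^ 2)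
    - (∑ i : Fin 3, xB i * v m i.succ) ^ 2 with hD
  have hDv : ∀ m, D m = ‖cross xB (spatial (v m))‖ ^ 2 := fun m => by
    rw [norm_cross_sq, norm_spatial_sq, real_inner_comm]
    rfl
  have hD0 : D 0 = rc Ne xB ^ 2 * rc Ne xB ^ 2 := by
    rw [hDv, hv0, spatial_event, cross_smul_right, norm_smul, mul_pow, norm_cross_sq, hNe,
      Real.norm_eq_abs, sq_abs]
    congr 1
    rw [rc_sq hNe hxB]
    ring
  have hDa : AnalyticAt ℝ D 0 := by
    refine (analyticAt_const.mul (Finset.analyticAt_fun_sum _ fun i _ => (hv _).pow 2)).sub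
      ((Finset.analyticAt_fun_sum _ fun i _ => analyticAt_const.mul (hv _)).pow 2)
  have hid : AnalyticAt ℝ (fun m : ℝ => m / ‖xB‖) 0 :=
    analyticAt_id.div analyticAt_const hxB.ne'
  have hv00 : v 0 0 = rc Ne xB := by rw [hv0]; rfl
  have hA' : AnalyticAt ℝ (fun m : ℝ => P.seriesA (m / ‖xB‖)) 0 :=
    AnalyticAt.fun_comp (by simpa using hA) hid
  have hB' : AnalyticAt ℝ (fun m : ℝ => P.seriesB (m / ‖xB‖)) 0 :=
    AnalyticAt.fun_comp (by simpa using hB) hid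
  have hsq : AnalyticAt ℝ (fun m => Real.sqrt (D m)) 0 :=
    AnalyticAt.fun_comp (analyticAt_sqrt (by rw [hD0]; positivity)) hDa
  refine ⟨fun m => P.seriesB (m / ‖xB‖) * Real.sqrt (D m) / (P.seriesA (m / ‖xB‖) * v m 0),
    (hB'.mul hsq).div (hA'.mul (hv 0)) ?_, ?_, ?_⟩
  · simp only [zero_div, P.seriesA_zero, one_mul, hv00]
    exact hrc.ne'
  · simp only [zero_div, P.seriesA_zero, P.seriesB_zero, one_mul, hv00, hD0,
      Real.sqrt_mul_self (sq_nonneg _)]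
    field_simp
  · have hBpos : ∀ᶠ m in 𝓝[>] (0 : ℝ), 0 < P.seriesB (m / ‖xB‖) :=
      (hB'.continuousAt.eventually (lt_mem_nhds (by simp [P.seriesB_zero]))).filter_mono
        nhdsWithin_le_nhds
    filter_upwards [hV, h.ray, hBpos] with m hm hray hb
    rw [hm, impactParameter, covector_metric_zero, spatial_covector_metric, hray.arrival,
      spatial_event, cross_smul_right, norm_smul, hDv, Real.sqrt_sq (norm_nonneg _), norm_neg]
    rw [show P.potBinv m ‖xB‖ = P.seriesB (m / ‖xB‖) from rfl,
      show P.potA m ‖xB‖ = P.seriesA (m / ‖xB‖) from rfl, Real.norm_of_nonneg hb.le]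

theorem IsRayFromInfinity.exists_orbit {P : PPN} {m rh : ℝ} {Ne xB : E3} {x0B : ℝ}
    {X V : ℝ → Event} (h : IsRayFromInfinity P m rh Ne xB x0B X V) (hm : 0 < m) (hrh : 0 < rh)
    (hNe : ‖Ne‖ = 1) {δ K b : ℝ} (hδ : m / rh < δ) (hP : ∀ y, |y| < δ → AnalyticAt ℝ P.seriesA y ∧
      AnalyticAt ℝ P.seriesB y ∧ 0 < P.seriesA y ∧ 0 < P.seriesB y)
    (hK : ∀ y, |y| < δ → |P.force y| ≤ K) (hb : 0 < b)
    (hbm : impactParameter (P.metric m) (X 0) (V 0) = b)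
    (hsmall : (m / b) ^ 2 * K * Real.pi < m / ‖xB‖) :
    (∀ s ≤ 0, impactParameter (P.metric m) (X s) (V s) = b) ∧
      ∃ w ω, IsOrbit P.force (m / b) (Real.pi - Real.arccos (inner ℝ Ne (unitDir xB))) (m / rh) w ω
        ∧ w (Real.pi - Real.arccos (inner ℝ Ne (unitDir xB))) = m / ‖xB‖ := by
  obtain ⟨p, k, ho, hi⟩ := h.exists_opticalRay hm hrh hδ hP
  have hX0 : spatial (X 0) = xB := by rw [h.arrival, spatial_event]
  have hb0 : ‖cross (spatial (X 0)) (p 0)‖ = b := (hi 0 le_rfl).symm.trans hbm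
  have hconst : ∀ s ≤ 0, ‖cross (spatial (X s)) (p s)‖ = b := fun s hs => by
    have := ho.angularMomentum_const hrh hs
    rw [← norm_cross_sq, ← norm_cross_sq, hb0] at this
    exact (sq_eq_sq₀ (norm_nonneg _) hb.le).1 this
  refine ⟨fun s hs => (hi s hs).trans (hconst s hs), ?_⟩
  have h00 := hP 0 (by simpa using (div_pos hm hrh).trans hδ)
  have hindex : ContinuousAt P.index 0 :=
    h00.2.1.continuousAt.div h00.1.continuousAt h00.2.2.1.ne'
  obtain ⟨ψ, w, ω, h1, h2, h3, h4, h5⟩ := ho.exists_orbit hm hrh hNe (K := K) (b := b)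
    (fun y hy => hK y (by rw [abs_of_nonneg hy.1]; exact hy.2.trans_lt hδ)) hindex
    (by simp [PPN.index, P.seriesA_zero, P.seriesB_zero]) hb (by rw [← norm_cross_sq, hb0])
    (by rw [hX0]; exact hsmall)
  -- The bound `ψ ≤ π` is what allows the angle to be recovered from its cosine.
  have hψ : ψ = Real.pi - Real.arccos (inner ℝ Ne (unitDir xB)) := by
    rw [← Real.arccos_neg, ← hX0, ← h3, Real.arccos_cos h1.le h2]
  rw [hX0] at h5
  subst hψ
  exact ⟨w, ω, h4, h5⟩

/-! ### The coefficients -/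

theorem eq_zero_of_abs_le_mul {f : ℝ → ℝ} {C : ℝ} (hf : ContinuousAt f 0)
    (h : ∀ᶠ x in 𝓝[>] (0 : ℝ), |f x| ≤ C * x) : f 0 = 0 := by
  have h1 : Tendsto f (𝓝[>] 0) (𝓝 (f 0)) := hf.tendsto.mono_left nhdsWithin_le_nhds
  have h2 : Tendsto (fun x : ℝ => C * x) (𝓝[>] 0) (𝓝 0) :=
    (Continuous.tendsto' (by fun_prop) 0 0 (by simp)).mono_left nhdsWithin_le_nhds
  exact tendsto_nhds_unique h1 (squeeze_zero_norm' h h2)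

theorem eventually_of_mul_self {f f' : ℝ → ℝ} {C : ℝ} {n : ℕ}
    (h : ∀ᶠ x in 𝓝[>] (0 : ℝ), |f x| ≤ C * x ^ (n + 1)) (hf : ∀ x, f x = x * f' x) :
    ∀ᶠ x in 𝓝[>] (0 : ℝ), |f' x| ≤ C * x ^ n := by
  filter_upwards [h, self_mem_nhdsWithin] with x hx (hx0 : 0 < x)
  rw [hf, abs_mul, abs_of_pos hx0, pow_succ] at hx
  refine le_of_mul_le_mul_left ?_ hx0
  linarith

/-- The terms linear in `h` agree, so the relation can be divided by `h ^ 2`. After multiplication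
by `R ^ 4` it reads `f₁ = O(h³)`; its value at `0` gives the first identity, which makes `f₁`
divisible by `h`, and the argument repeats twice. -/
theorem coeff_of_inverse_expansion {σ Y₁ Y₂ Y₃ q₁ q₂ q₃ C : ℝ} {Q ρ : ℝ → ℝ}
    (hρ : ContinuousAt ρ 0)
    (hQ : ∀ᶠ h in 𝓝[>] (0 : ℝ), Q h = 1 + q₁ * h + q₂ * h ^ 2 + q₃ * h ^ 3 + h ^ 4 * ρ h)
    (hY : ∀ᶠ h in 𝓝[>] (0 : ℝ), |h * σ - (h / Q h * σ + (h / Q h) ^ 2 * Y₁ + (h / Q h) ^ 3 * Y₂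
      + (h / Q h) ^ 4 * Y₃)| ≤ C * (h / Q h) ^ 5) :
    σ * q₁ = Y₁ ∧ σ * (q₂ + q₁ ^ 2) = Y₂ ∧ σ * (q₃ + 3 * q₁ * q₂ + q₁ ^ 3) = Y₃ := by
  -- Horner form of `Q`: each function is the previous quotient, so dividing by `h` needs no series
  -- manipulation.
  set u₃ : ℝ → ℝ := fun h => q₃ + h * ρ h with hu₃
  set u₂ : ℝ → ℝ := fun h => q₂ + h * u₃ h with hu₂
  set u : ℝ → ℝ := fun h => q₁ + h * u₂ h with hu
  set R : ℝ → ℝ := fun h => 1 + h * u h with hR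
  have c3 : ContinuousAt u₃ 0 := by fun_prop
  have c2 : ContinuousAt u₂ 0 := by fun_prop
  have c1 : ContinuousAt u 0 := by fun_prop
  have c0 : ContinuousAt R 0 := by fun_prop
  have hQR : ∀ᶠ h in 𝓝[>] (0 : ℝ), Q h = R h := by
    filter_upwards [hQ] with h hh
    rw [hh]
    simp only [hR, hu, hu₂, hu₃]
    ring
  -- This lower bound on `R` accounts for the factor 2 in the constant `2 * |C|` below.
  have hRhalf : ∀ᶠ h in 𝓝[>] (0 : ℝ), 1 / 2 < R h :=
    (c0.eventually (lt_mem_nhds (by simp [hR]; norm_num))).filter_mono nhdsWithin_le_nhds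
  set f₁ : ℝ → ℝ := fun h => σ * R h ^ 3 * u h - Y₁ * R h ^ 2 - h * Y₂ * R h - h ^ 2 * Y₃ with hf₁
  have b1 : ∀ᶠ h in 𝓝[>] (0 : ℝ), |f₁ h| ≤ 2 * |C| * h ^ (2 + 1) := by
    filter_upwards [hY, hQR, hRhalf, self_mem_nhdsWithin] with h h1 h2 h3 (h4 : 0 < h)
    rw [h2] at h1
    have hRpos : 0 < R h := by linarith
    have e1 : h * σ - (h / R h * σ + (h / R h) ^ 2 * Y₁ + (h / R h) ^ 3 * Y₂
        + (h / R h) ^ 4 * Y₃) = h ^ 2 / R h ^ 4 * f₁ h := by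
      simp only [hf₁]
      have : h * σ - h / R h * σ = h ^ 2 / R h ^ 4 * (σ * R h ^ 3 * u h) := by
        have : h * u h = R h - 1 := by simp only [hR]; ring
        field_simp
        linear_combination (-(σ * R h ^ 3)) * this
      rw [← sub_sub, ← sub_sub, ← sub_sub, this]
      field_simp
    rw [e1, abs_mul, abs_of_pos (by positivity)] at h1
    have h5 : |f₁ h| ≤ C * h ^ 3 / R h := by
      refine le_of_mul_le_mul_left (h1.trans (le_of_eq ?_))
        (show 0 < h ^ 2 / R h ^ 4 by positivity)
      field_simp
    refine h5.trans ?_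
    rw [div_le_iff₀ hRpos]
    have : C ≤ |C| := le_abs_self C
    have hC := abs_nonneg C
    calc C * h ^ 3 ≤ |C| * h ^ 3 := by gcongr
      _ = 2 * |C| * h ^ (2 + 1) * (1 / 2) := by ring
      _ ≤ _ := by gcongr
  have le1 : ∀ {f : ℝ → ℝ} {n : ℕ}, (∀ᶠ h in 𝓝[>] (0 : ℝ), |f h| ≤ 2 * |C| * h ^ (n + 1)) →
      ∀ᶠ h in 𝓝[>] (0 : ℝ), |f h| ≤ 2 * |C| * h := fun hf => by
    filter_upwards [hf, Ioo_mem_nhdsGT (zero_lt_one' ℝ)] with h hh h01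
    refine hh.trans ?_
    gcongr
    exact pow_le_of_le_one h01.1.le h01.2.le (by omega)
  have e1 : σ * q₁ = Y₁ := by
    have := eq_zero_of_abs_le_mul (f := f₁) (by fun_prop) (le1 b1)
    simp [hf₁, hR, hu] at this
    linarith
  set f₂ : ℝ → ℝ := fun h => σ * R h ^ 2 * (u₂ h + u h ^ 2) - Y₂ * R h - h * Y₃ with hf₂
  have b2 : ∀ᶠ h in 𝓝[>] (0 : ℝ), |f₂ h| ≤ 2 * |C| * h ^ (1 + 1) := by
    refine eventually_of_mul_self b1 fun h => ?_
    simp only [hf₁, hf₂, ← e1]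
    have h1 : R h = 1 + h * u h := rfl
    have h2 : u h = q₁ + h * u₂ h := rfl
    linear_combination (σ * R h ^ 2 * u h) * h1 + (σ * R h ^ 2) * h2
  have e2 : σ * (q₂ + q₁ ^ 2) = Y₂ := by
    have := eq_zero_of_abs_le_mul (f := f₂) (by fun_prop) (le1 b2)
    simp [hf₂, hR, hu, hu₂] at this
    linarith
  set f₃ : ℝ → ℝ := fun h =>
    σ * R h * (u₃ h + u₂ h * (u h + q₁) + u h * (u₂ h + u h ^ 2)) - Y₃ with hf₃
  have b3 : ∀ᶠ h in 𝓝[>] (0 : ℝ), |f₃ h| ≤ 2 * |C| * h ^ (0 + 1) := by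
    refine eventually_of_mul_self b2 fun h => ?_
    simp only [hf₂, hf₃, ← e2]
    have h1 : R h = 1 + h * u h := rfl
    have h2 : u h = q₁ + h * u₂ h := rfl
    have h3 : u₂ h = q₂ + h * u₃ h := rfl
    linear_combination (σ * R h * (u₂ h + u h ^ 2)) * h1 + (σ * R h) * h3
      + (σ * R h * (u h + q₁)) * h2
  have e3 : σ * (q₃ + 3 * q₁ * q₂ + q₁ ^ 3) = Y₃ := by
    have := eq_zero_of_abs_le_mul (f := f₃) (by fun_prop) (le1 b3)
    simp [hf₃, hR, hu, hu₂, hu₃] at this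
    linear_combination this
  exact ⟨e1, e2, e3⟩

/-- With `t = σ / (1 - c)` one has `t σ = 1 + c` and `t² = (1 + c) / (1 - c)`; in terms of `t` and
`z = ψ / σ` the three relations are solved successively, each being linear in its new unknown. -/
theorem coeff_formulas (P : PPN) {σ c q₁ q₂ q₃ : ℝ} (hσ : 0 < σ) (hc : c < 1)
    (hσc : σ ^ 2 = 1 - c ^ 2)
    (hsin : Real.sin (Real.pi - Real.arccos c) = σ)
    (hcos : Real.cos (Real.pi - Real.arccos c) = -c) {Q ρ : ℝ → ℝ} {C : ℝ}
    (hρ : ContinuousAt ρ 0)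
    (hQ : ∀ᶠ h in 𝓝[>] (0 : ℝ), Q h = 1 + q₁ * h + q₂ * h ^ 2 + q₃ * h ^ 3 + h ^ 4 * ρ h)
    (hY : ∀ᶠ h in 𝓝[>] (0 : ℝ), |h * σ - orbitPoly (1 + P.gamma) (2 * P.kappa) (3 * P.kappa3)
      (Real.pi - Real.arccos c) (h / Q h)| ≤ C * (h / Q h) ^ 5) :
    q₁ = (1 + P.gamma) * (σ / (1 - c)) ∧
    q₂ = P.kappa * (1 + c * ((Real.pi - Real.arccos c) / σ))
      - (1 + P.gamma) ^ 2 * ((1 + c) / (1 - c)) ∧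
    q₃ = σ / (1 - c) * (P.kappa3 * (1 + c) + 2 * (1 + P.gamma) ^ 3 * ((1 + c) / (1 - c))
      - (1 + P.gamma) * P.kappa * (1 + (1 + 2 * c) * ((Real.pi - Real.arccos c) / σ))) := by
  set ψ : ℝ := Real.pi - Real.arccos c
  obtain ⟨e1, e2, e3⟩ := coeff_of_inverse_expansion hρ hQ (by
    simpa only [orbitPoly, hsin, hcos] using hY)
  set z : ℝ := ψ / σ with hz
  set t : ℝ := σ / (1 - c) with ht
  have hc' : 0 < 1 - c := by linarith
  have hψz : ψ = z * σ := by rw [hz]; field_simp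
  have htc : t * (1 - c) = σ := by rw [ht]; field_simp
  have htσ : t * σ = 1 + c := by
    rw [ht]
    field_simp
    linarith
  have ht2 : (1 + c) / (1 - c) = t ^ 2 := by
    rw [div_eq_iff hc'.ne', ← htσ, ← htc]
    ring
  rw [ht2]
  rw [hψz] at e2 e3
  have r1 : q₁ = (1 + P.gamma) * t := by
    refine mul_left_cancel₀ hσ.ne' ?_
    linear_combination e1 - (1 + P.gamma) * htσ
  have r2 : q₂ = P.kappa * (1 + c * z) - (1 + P.gamma) ^ 2 * t ^ 2 := by
    refine mul_left_cancel₀ hσ.ne' ?_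
    rw [r1] at e2
    linear_combination e2
  refine ⟨r1, r2, ?_⟩
  refine mul_left_cancel₀ hσ.ne' ?_
  rw [r1, r2] at e3
  linear_combination e3 - (2 * P.kappa * (1 + P.gamma) + P.kappa3 * (1 + c)) * htσ
    + (1 + P.gamma) * P.kappa * z * σ * htc

end LightRay

/-! ### Comparison of coefficients and independence of the ray. -/

open LightRay in
theorem proposition8 (P : PPN) (m₀ rh : ℝ) (hm₀ : 0 < m₀) (hrh : 0 < rh)
    (hreg : P.RegularOutside m₀ rh)
    (Ne xB : E3) (hNe : ‖Ne‖ = 1) (hxB : rh < ‖xB‖)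
    (hnonradial : cross Ne (unitDir xB) ≠ 0)
    (hline : ∀ s : ℝ, s ≤ 0 → rh < ‖(s * rc Ne xB) • Ne + xB‖) :
    ∃ q : ℕ → ℝ,
      q 1 = (1 + P.gamma) *
        (‖cross Ne (unitDir xB)‖ / (1 - inner ℝ Ne (unitDir xB))) ∧
      q 2 = P.kappa * (1 + inner ℝ Ne (unitDir xB) *
          ((Real.pi - Real.arccos (inner ℝ Ne (unitDir xB))) / ‖cross Ne (unitDir xB)‖))
        - (1 + P.gamma) ^ 2 *
          ((1 + inner ℝ Ne (unitDir xB)) / (1 - inner ℝ Ne (unitDir xB))) ∧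
      q 3 = ‖cross Ne (unitDir xB)‖ / (1 - inner ℝ Ne (unitDir xB)) *
        (P.kappa3 * (1 + inner ℝ Ne (unitDir xB))
          + 2 * (1 + P.gamma) ^ 3 *
            ((1 + inner ℝ Ne (unitDir xB)) / (1 - inner ℝ Ne (unitDir xB)))
          - (1 + P.gamma) * P.kappa * (1 + (1 + 2 * inner ℝ Ne (unitDir xB)) *
            ((Real.pi - Real.arccos (inner ℝ Ne (unitDir xB))) /
              ‖cross Ne (unitDir xB)‖))) ∧
      ∀ (x0B : ℝ) (X V : ℝ → ℝ → Event),
        IsQuasiMinkowskianFromInfinity P rh Ne xB x0B X V →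
        ∀ᶠ m in 𝓝[>] (0 : ℝ), ∃ S : ℝ,
          HasSum (fun n : ℕ => (m / rc Ne xB) ^ (n + 1) * q (n + 1)) S ∧
          ∀ s : ℝ, s ≤ 0 →
            impactParameter (P.metric m) (X m s) (V m s) = rc Ne xB * (1 + S) := by
  have hxB0 : 0 < ‖xB‖ := hrh.trans hxB
  set σ : ℝ := ‖cross Ne (unitDir xB)‖ with hσd
  set c : ℝ := inner ℝ Ne (unitDir xB) with hcd
  have hσ : 0 < σ := norm_pos_iff.2 hnonradial
  have hrcσ : rc Ne xB = ‖xB‖ * σ := rfl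
  have hrc : 0 < rc Ne xB := mul_pos hxB0 hσ
  have hσc : σ ^ 2 = 1 - c ^ 2 := by
    rw [hσd, norm_cross_sq, hNe, unitDir, norm_smul, norm_inv, norm_norm,
      inv_mul_cancel₀ hxB0.ne']
    norm_num [hcd, unitDir]
  have hc1 : -1 < c ∧ c < 1 := abs_lt.1 ((sq_lt_one_iff_abs_lt_one c).1 (by nlinarith))
  set ψ : ℝ := Real.pi - Real.arccos c with hψd
  have hsin : Real.sin ψ = σ := by
    rw [hψd, Real.sin_pi_sub, Real.sin_arccos, ← hσc, Real.sqrt_sq hσ.le]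
  have hcos : Real.cos ψ = -c := by
    rw [hψd, Real.cos_pi_sub, Real.cos_arccos hc1.1.le hc1.2.le]
  have hψ0 : 0 < ψ := sub_pos.2 (Real.arccos_lt_pi.2 hc1.1)
  have hψπ : ψ < Real.pi := sub_lt_self _ (Real.arccos_pos.2 hc1.2)
  obtain ⟨δ, hδ, K, hK, hP, hL⟩ := PPN.exists_local_bounds hm₀ hrh hreg
  have h00 := hP 0 (by simpa using hδ)
  have main : ∀ (x0B : ℝ) (X V : ℝ → ℝ → Event),
      IsQuasiMinkowskianFromInfinity P rh Ne xB x0B X V →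
      ∃ b : ℝ → ℝ, AnalyticAt ℝ b 0 ∧ b 0 = rc Ne xB ∧ ∀ᶠ m in 𝓝[>] (0 : ℝ), 0 < b m ∧
        (∀ s ≤ 0, impactParameter (P.metric m) (X m s) (V m s) = b m) ∧
        ∃ w ω, IsOrbit P.force (m / b m) ψ (m / rh) w ω ∧ w ψ = m / ‖xB‖ := by
    intro x0B X V h
    obtain ⟨b, hba, hb0, hb⟩ := h.exists_analytic_impact hNe hxB0 hrc h00.1 h00.2.1
    refine ⟨b, hba, hb0, ?_⟩
    have ev1 : ∀ᶠ m in 𝓝[>] (0 : ℝ), 0 < b m :=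
      (hba.continuousAt.eventually (lt_mem_nhds (by rw [hb0]; exact hrc))).filter_mono
        nhdsWithin_le_nhds
    -- This is the smallness condition that keeps the swept angle below `π`, cleared of
    -- denominators; it holds near `m = 0` because `b` tends to `r_c > 0`.
    have ev2 : ∀ᶠ m in 𝓝[>] (0 : ℝ), 0 < b m ^ 2 - m * K * Real.pi * ‖xB‖ := by
      have hcont : ContinuousAt (fun m => b m ^ 2 - m * K * Real.pi * ‖xB‖) 0 :=
        (hba.continuousAt.pow 2).sub (by fun_prop)
      refine (hcont.eventually (lt_mem_nhds ?_)).filter_mono nhdsWithin_le_nhds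
      simpa [hb0] using pow_pos hrc 2
    filter_upwards [hb, h.ray, ev1, ev2, Ioo_mem_nhdsGT (mul_pos hδ hrh)] with m h1 h2 h3 h4 h5
    have hsmall : (m / b m) ^ 2 * K * Real.pi < m / ‖xB‖ := by
      have := h5.1
      rw [div_pow, lt_div_iff₀ hxB0, div_mul_eq_mul_div, div_mul_eq_mul_div, div_mul_eq_mul_div,
        div_lt_iff₀ (by positivity)]
      nlinarith
    exact ⟨h3, h2.exists_orbit h5.1 hrh hNe ((div_lt_iff₀ hrh).2 h5.2)
      (fun y hy => ⟨(hP y hy).1, (hP y hy).2.1, (hP y hy).2.2.1, (hP y hy).2.2.2.1⟩)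
      (fun y hy => (hP y hy).2.2.2.2.1) h3 h1 hsmall⟩
  have hsmallη : ∀ᶠ m in 𝓝[>] (0 : ℝ), 0 < m ∧ m / rh < δ := by
    filter_upwards [Ioo_mem_nhdsGT (mul_pos hδ hrh)] with m hm
    exact ⟨hm.1, (div_lt_iff₀ hrh).2 hm.2⟩
  have hμsmall : ∀ {b : ℝ → ℝ}, AnalyticAt ℝ b 0 → b 0 = rc Ne xB → ∀ {ε : ℝ}, 0 < ε →
      ∀ᶠ m in 𝓝[>] (0 : ℝ), m / b m < ε := by
    intro b hb hb0 ε hε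
    have : ContinuousAt (fun m => m / b m) 0 :=
      continuousAt_id.div hb.continuousAt (by rw [hb0]; exact hrc.ne')
    exact (this.eventually (gt_mem_nhds (by simpa using hε))).filter_mono nhdsWithin_le_nhds
  -- The coefficients have to be chosen before the ray: they are read off from one ray, if there is
  -- any, and uniqueness of the orbit carries them over to all others.
  by_cases hex : ∃ x0B X V, IsQuasiMinkowskianFromInfinity P rh Ne xB x0B X V
  · obtain ⟨x0B, X, V, h⟩ := hex
    obtain ⟨b, hba, hb0, hb⟩ := main x0B X V h
    obtain ⟨p, hp⟩ := hba
    have hsum : ∀ᶠ m in 𝓝 (0 : ℝ), HasSum (fun n => p.coeff n * m ^ n) (b m) := by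
      filter_upwards [hasFPowerSeriesAt_iff.1 hp] with m hm
      simpa [mul_comm] using hm
    have hcoeff0 : p.coeff 0 = rc Ne xB := by
      have h1 := hsum.self_of_nhds
      have h2 := hasSum_single (f := fun n => p.coeff n * (0 : ℝ) ^ n) 0
        (fun n hn => by simp [hn])
      simpa [hb0] using (h1.unique h2).symm
    -- Rescaling from powers of `m` to powers of `m / r_c`, normalized so that `q 0 = 1`.
    set q : ℕ → ℝ := fun n => p.coeff n * rc Ne xB ^ n / rc Ne xB with hq
    have hqsum : ∀ᶠ h in 𝓝 (0 : ℝ), HasSum (fun n => q n * h ^ n) (b (rc Ne xB * h) / rc Ne xB) := by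
      have ht : Tendsto (fun h : ℝ => rc Ne xB * h) (𝓝 0) (𝓝 0) :=
        Continuous.tendsto' (by fun_prop) 0 0 (by simp)
      filter_upwards [ht.eventually hsum] with h hh
      refine (hh.div_const (rc Ne xB)).congr_fun ?_
      intro n
      simp only [hq]
      ring
    have hq0 : q 0 = 1 := by
      simp only [hq, hcoeff0]
      field_simp
    obtain ⟨ε, hε, hqε⟩ := Metric.eventually_nhds_iff.1 hqsum
    have hqs : Summable fun n => q n * (ε / 2) ^ n :=
      (hqε (by rw [Real.dist_eq, sub_zero, abs_of_pos (by positivity)]; linarith)).summable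
    have hε2 : ε / 2 ≠ 0 := by positivity
    obtain ⟨C, hC⟩ := exists_orbit_expansion hK (fun x hx => (hP x hx).2.2.2.2.1)
      (fun x hx => (hP x hx).2.2.2.2.2)
    have htend : Tendsto (fun h : ℝ => rc Ne xB * h) (𝓝[>] 0) (𝓝[>] 0) := by
      refine tendsto_nhdsWithin_iff.2 ⟨(Continuous.tendsto' (by fun_prop) 0 0 (by simp)).mono_left
        nhdsWithin_le_nhds, ?_⟩
      filter_upwards [self_mem_nhdsWithin] with h hh
      exact mul_pos hrc hh
    obtain ⟨f1, f2, f3⟩ := coeff_formulas P (q₁ := q 1) (q₂ := q 2) (q₃ := q 3) (C := C)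
      (Q := fun h => b (rc Ne xB * h) / rc Ne xB) (ρ := fun h => ∑' n, q (n + 4) * h ^ n)
      hσ hc1.2 hσc hsin hcos
      (analyticAt_tsum hε2 (summable_shift hε2 hqs 4)).continuousAt
      (by
        filter_upwards [hqsum.filter_mono nhdsWithin_le_nhds,
          (eventually_abs_lt (abs_pos.2 hε2)).filter_mono nhdsWithin_le_nhds] with h h1 h2
        rw [← h1.tsum_eq, tsum_eq_sum_add_pow_mul hqs h2 4]
        simp [Finset.sum_range_succ, hq0])
      (by
        filter_upwards [htend.eventually hb, htend.eventually hsmallη,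
          htend.eventually (hμsmall ⟨p, hp⟩ hb0 one_pos)] with h h1 h2 h3
        obtain ⟨hb1, -, w, ω, ho, hw⟩ := h1
        have := hC _ ψ _ w ω (div_pos h2.1 hb1) h3.le hψ0 hψπ.le h2.2 ho
        rw [hw] at this
        have e1 : rc Ne xB * h / ‖xB‖ = h * σ := by
          rw [hrcσ]
          field_simp
        have e2 : rc Ne xB * h / b (rc Ne xB * h) = h / (b (rc Ne xB * h) / rc Ne xB) := by
          field_simp
        rwa [e1, e2] at this)
    refine ⟨q, f1, f2, f3, fun x0B' X' V' h' => ?_⟩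
    obtain ⟨b', hba', hb0', hb'⟩ := main x0B' X' V' h'
    obtain ⟨μ₀, hμ₀, huniq⟩ := exists_orbit_unique hK (fun x hx => (hP x hx).2.2.2.2.1) hL hψ0 hψπ
    have htdiv : Tendsto (fun m : ℝ => m / rc Ne xB) (𝓝[>] 0) (𝓝 0) :=
      (Continuous.tendsto' (by fun_prop) 0 0 (by simp)).mono_left nhdsWithin_le_nhds
    filter_upwards [hb, hb', hsmallη, hμsmall ⟨p, hp⟩ hb0 hμ₀, hμsmall hba' hb0' hμ₀,
      htdiv.eventually hqsum] with m l l' k3 k4 k5 k6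
    obtain ⟨k1, -, w, ω, ho, hw⟩ := l
    obtain ⟨k1', k2', w', ω', ho', hw'⟩ := l'
    have hμ := huniq _ _ _ w ω w' ω' (div_pos k3.1 k1) k4 (div_pos k3.1 k1') k5 k3.2 ho ho'
      (hw.trans hw'.symm)
    have hbb : b m = b' m := by
      rw [div_eq_div_iff k1.ne' k1'.ne'] at hμ
      exact (mul_left_cancel₀ k3.1.ne' hμ).symm
    rw [mul_div_cancel₀ _ hrc.ne'] at k6
    -- Removing the term `q 0 = 1` gives the series indexed by `n + 1`, with sum `b / r_c - 1`.
    have k7 := (hasSum_nat_add_iff' 1).2 k6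
    simp only [Finset.sum_range_one, pow_zero, mul_one, hq0] at k7
    refine ⟨b m / rc Ne xB - 1, ?_, fun s hs => ?_⟩
    · simpa only [mul_comm] using k7
    · rw [k2' s hs, ← hbb]
      field_simp
      ring
  -- Without any ray the last clause is vacuous; the placeholders are filled with the three required
  -- values by `rfl`.
  · refine ⟨fun n => if n = 1 then _ else if n = 2 then _ else _, rfl, rfl, rfl,
      fun x0B X V h => (hex ⟨x0B, X, V, h⟩).elim⟩
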